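/- For $0\le x\le 1$ and positive integers $s_1,\dots,s_k$ ($k\ge 1$, with $s_1>1$ if $x=1$) put \[ \zeta_x(s_1,\dots,s_k)=\sum_{n_1>\cdots>n_k>0}x^{n_1}\prod_{j=1}^k n_j^{-s_j}, \] and let $(3,\{1,3\}^n)$ denote the string $3,1,3,1,3,\dots,1,3$ of length $2n+1$. Let $F(a,b;c;x)={}_2F_1(a,b;c;x)$ be the Gaussian hypergeometric series, let $\psi=\Gamma'/\Gamma$, and put \[ Y_1(x,z)=F(z,-z;1;x)\quad(|x|\le 1),\qquad Y_2(x,z)=(1-x)F(1+z,1-z;2;1-x)\quad(|1-x|<1), \] \[ G(z)=\tfrac14\{\psi(1+iz)+\psi(1-iz)-\psi(1+z)-\psi(1-z)\} \] for complex $z$ not a positive integer multiple of $\pm1$ or $\pm i$. Then for each real $x$ with $0\le x\le 1$, the sums $\zeta_x(3,\{1,3\}^n)$, $n\ge 0$, converge, and the formal power series \[ S(x,z)=\sum_{n=0}^\infty(-1)^n z^{4n+2}\,4^n\,\zeta_x(3,\{1,3\}^n) \] converges for every complex $z$ and defines an entire function of $z$. Furthermore, \[ S(x,z)=G(z)Y_1(x,z)Y_1(x,iz)-\frac{Y_1(x,iz)Y_2(x,z)}{4Y_1(1,z)}+\frac{Y_1(x,z)Y_2(x,iz)}{4Y_1(1,iz)}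 \] for all pairs $(x,z)$ for which the right-hand side is defined, that is, for all real $x$ with $0<x\le1$ and all complex $z$ that are not positive integer multiples of $\pm1$ or $\pm i$. -/

import Mathlib

namespace PeriodTwo

/-- Index set of the sum defining a depth-`k` multiple polylogarithm:
tuples of integers `n 0 > n 1 > ⋯ > n (k - 1) > 0`. -/
abbrev DecTuple (k : ℕ) : Type :=
  {n : Fin k → ℕ // StrictAnti n ∧ ∀ j, 0 < n j}

/-- The summand `x ^ n₁ * ∏ j, n_j ^ (-s_j)`; here `n 0` is the largest index. -/
noncomputable def zetaTerm (x : ℝ) {k : ℕ} (s : Fin (k + 1) → ℕ) (n : DecTuple (k + 1)) : ℝ :=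
  x ^ (n.1 0) * ∏ j, ((n.1 j : ℝ) ^ (s j))⁻¹

/-- The parametrized multiple zeta function
`ζ_x(s₁, …, s_k) = ∑_{n₁ > ⋯ > n_k > 0} x ^ n₁ ∏ j, n_j ^ (-s_j)` (depth at least one). -/
noncomputable def zetaX (x : ℝ) {k : ℕ} (s : Fin (k + 1) → ℕ) : ℝ :=
  ∑' n : DecTuple (k + 1), zetaTerm x s n

/-- The argument string `3, {1, 3}^n = 3, 1, 3, 1, 3, …, 1, 3` of length `2 * n + 1`. -/
def args313 (n : ℕ) : Fin (2 * n + 1) → ℕ :=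
  fun j => if Even (j : ℕ) then 3 else 1

/-- The `n`-th term of the series `S(x, z)`. -/
noncomputable def STerm (x : ℝ) (z : ℂ) (n : ℕ) : ℂ :=
  (-1) ^ n * z ^ (4 * n + 2) * 4 ^ n * (zetaX x (args313 n) : ℂ)

/-- `S(x, z) = ∑ n, (-1)^n z^(4n+2) 4^n ζ_x(3, {1, 3}^n)`. -/
noncomputable def S (x : ℝ) (z : ℂ) : ℂ :=
  ∑' n : ℕ, STerm x z n

/-- `Y₁(x, z) = F(z, -z; 1; x)`, for `|x| ≤ 1`. -/
noncomputable def Y₁ (x z : ℂ) : ℂ :=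
  ordinaryHypergeometric z (-z) (1 : ℂ) x

/-- `Y₂(x, z) = (1 - x) F(1 + z, 1 - z; 2; 1 - x)`, for `|1 - x| < 1`. -/
noncomputable def Y₂ (x z : ℂ) : ℂ :=
  (1 - x) * ordinaryHypergeometric (1 + z) (1 - z) (2 : ℂ) (1 - x)

/-- `G(z) = (ψ(1 + iz) + ψ(1 - iz) - ψ(1 + z) - ψ(1 - z)) / 4`, for `z` not a positive
integer multiple of `±1` or `±i`. -/
noncomputable def G (z : ℂ) : ℂ :=
  (1 / 4) * (Complex.digamma (1 + Complex.I * z) + Complex.digamma (1 - Complex.I * z)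
    - Complex.digamma (1 + z) - Complex.digamma (1 - z))

end PeriodTwo

/-!
Fix `z` and write `D₀ = x d/dx`, `D₁ = (1 - x) d/dx`. On a multiple polylogarithm `ζ_x(s₁, s₂, …)`
the operator `D₀` lowers `s₁ > 1` by one and `D₁` removes `s₁ = 1`, so `D₁² D₀²` maps
`ζ_x(3, {1, 3}^n)` to `ζ_x(3, {1, 3}^(n - 1))` for `n ≥ 1` and kills `ζ_x(3)`; therefore `S = S x z`
satisfies `D₁² D₀² S = -4 z⁴ S`.
The functions `Y₁ x z` and `Y₂ x z` are solutions of `D₁ D₀ y = -z² y`, and the product of a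
solution for `z` with one for `i z` solves the fourth-order equation (`HypSystem.mul`). Hence both
sides of the identity solve `D₁² D₀² T = -4 z⁴ T`, written below as a first-order system for
`T`, `D₀ T`, `D₀² T`, `D₁ D₀² T`.

A solution of that system on `(0, 1)` is determined by its limits at `0` (`QuarticSystem.eq_zero`),
and both sides have the limits `0, 0, 0, z²`. For `S` this is read off the power series in `x`.
For the right-hand side one needs, with `C = Y₁ 1 z`,

* `D₀ Y₂(x, z) = -Y₁(1 - x, z)`, which tends to `-C`;
* `Y₂(x, z) + C log x → C (2 ψ(1) - ψ(1 + z) - ψ(1 - z))`, which makes the digamma functions in `G`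
  cancel.

With `P n = ∏_{k ≤ n} (1 - z² / k²)`, one has `Y₂(x, z) = ∑ P n (1 - x)^(n + 1) / (n + 1)` and
`P n → C`, so the second limit is `∑ (P n - C) / (n + 1)`. By Abel summation this sum is the
derivative in `c` at `c = 1` of `F(z, -z; c; 1)` (`tendsto_gaussSum_slope`), which Gauss's theorem
evaluates as `Γ(c)² / (Γ(c - z) Γ(c + z))` (`gaussSum_eq_Gamma`). Gauss's theorem in turn follows
from the contiguous relation between `c` and `c + 1` and Euler's product for `Γ`. The case `x = 1`
follows by continuity.

All convergence statements about the sums `ζ_x(3, {1, 3}^n)` come from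
`1 + ∑ t^(n + 1) ζ(3, {1, 3}^n) ≤ ∏ (1 + t / m²) ≤ exp (t ∑ 1 / m²)` for `t ≥ 0`
(`sum_coeff313_le`).
-/

namespace PeriodTwo

open Filter Topology

/-! ### Power series with polynomially bounded coefficients -/

/-- The sum of the power series `∑ c n * x ^ n`. -/
noncomputable def ps (c : ℕ → ℂ) (x : ℂ) : ℂ := ∑' n, c n * x ^ n

/-- Coefficient sequences of at most polynomial growth: their power series converge in the open
unit disc, and the class is closed under multiplication by `n` and under partial sums. -/
def PolyBdd (c : ℕ → ℂ) : Prop := ∃ (K : ℝ) (d : ℕ), ∀ n, ‖c n‖ ≤ K * ((n : ℝ) + 1) ^ d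

lemma PolyBdd.of_bounded {c : ℕ → ℂ} (K : ℝ) (h : ∀ n, ‖c n‖ ≤ K) : PolyBdd c :=
  ⟨K, 0, by simpa using h⟩

lemma PolyBdd.natCast_mul {c : ℕ → ℂ} (h : PolyBdd c) : PolyBdd fun n => n * c n := by
  obtain ⟨K, d, hK⟩ := h
  refine ⟨K, d + 1, fun n => ?_⟩
  rw [norm_mul, Complex.norm_natCast, pow_succ]
  have h1 := hK n
  have h2 : (0 : ℝ) ≤ n := n.cast_nonneg
  calc (n : ℝ) * ‖c n‖ ≤ (n + 1) * ‖c n‖ := by gcongr; linarith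
    _ ≤ (n + 1) * (K * ((n : ℝ) + 1) ^ d) := by gcongr
    _ = _ := by ring

lemma PolyBdd.summable_norm {c : ℕ → ℂ} (h : PolyBdd c) {x : ℂ} (hx : ‖x‖ < 1) :
    Summable fun n => ‖c n * x ^ n‖ := by
  obtain ⟨K, d, hK⟩ := h
  rcases (norm_nonneg x).eq_or_lt with h0 | h0
  · refine summable_of_ne_finset_zero (s := {0}) fun n hn => ?_
    have : n ≠ 0 := by simpa using hn
    simp [norm_eq_zero.mp h0.symm, this]
  have h1 : Summable fun n : ℕ => ((n + 1 : ℕ) : ℝ) ^ d * ‖x‖ ^ (n + 1) :=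
    (summable_nat_add_iff 1).mpr
      (summable_pow_mul_geometric_of_norm_lt_one d (r := ‖x‖) (by simpa using hx))
  refine Summable.of_nonneg_of_le (fun _ => norm_nonneg _) (fun n => ?_) (h1.mul_left (K / ‖x‖))
  rw [norm_mul, norm_pow]
  calc ‖c n‖ * ‖x‖ ^ n ≤ K * ((n : ℝ) + 1) ^ d * ‖x‖ ^ n := by gcongr; exact hK n
    _ = _ := by push_cast; field_simp; ring

lemma PolyBdd.summable {c : ℕ → ℂ} (h : PolyBdd c) {x : ℂ} (hx : ‖x‖ < 1) :
    Summable fun n => c n * x ^ n := (h.summable_norm hx).of_norm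

lemma ps_zero (c : ℕ → ℂ) : ps c 0 = c 0 := by
  rw [ps, tsum_eq_single 0 fun n hn => by simp [hn]]; simp

lemma ps_const_mul (a : ℂ) (c : ℕ → ℂ) (x : ℂ) : ps (fun n => a * c n) x = a * ps c x := by
  simp only [ps, mul_assoc, tsum_mul_left]

lemma PolyBdd.hasDerivAt {c : ℕ → ℂ} (h : PolyBdd c) {x : ℂ} (hx : ‖x‖ < 1) :
    HasDerivAt (ps c) (∑' n : ℕ, (n + 1) * c (n + 1) * x ^ n) x := by
  obtain ⟨r, hxr, hr⟩ := exists_between hx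
  have hr0 : 0 ≤ r := (norm_nonneg x).trans hxr.le
  have hr0' : 0 < r := (norm_nonneg x).trans_lt hxr
  have hs := (h.natCast_mul.summable_norm (x := r) (by simpa [abs_of_nonneg hr0] using hr))
  have key : HasDerivAt (fun y => ∑' n, c n * y ^ n) (∑' n : ℕ, c n * (n * x ^ (n - 1))) x := by
    refine hasDerivAt_tsum_of_isPreconnected (t := Metric.ball 0 r) (y₀ := x)
      (hs.mul_left r⁻¹) Metric.isOpen_ball (convex_ball 0 r).isPreconnected
      (fun n y _ => (hasDerivAt_pow n y).const_mul (c n)) (fun n y hy => ?_)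
      (by simpa using hxr) (h.summable hx) (by simpa using hxr)
    have hy : ‖y‖ ≤ r := by simpa using (mem_ball_zero_iff.mp hy).le
    rcases n with _ | n
    · simp
    simp only [norm_mul, norm_pow, Complex.norm_natCast, Complex.norm_real, Real.norm_eq_abs,
      abs_of_nonneg hr0, Nat.add_sub_cancel]
    calc ‖c (n + 1)‖ * (((n + 1 : ℕ) : ℝ) * ‖y‖ ^ n)
        ≤ ‖c (n + 1)‖ * (((n + 1 : ℕ) : ℝ) * r ^ n) := by gcongr
      _ = _ := by field_simp; ring
  have hsum : Summable fun n : ℕ => c n * (n * x ^ (n - 1)) := by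
    refine Summable.of_norm_bounded (hs.mul_left r⁻¹) fun n => ?_
    rcases n with _ | n
    · simp
    simp only [norm_mul, norm_pow, Complex.norm_natCast, Complex.norm_real, Real.norm_eq_abs,
      abs_of_nonneg hr0, Nat.add_sub_cancel]
    calc ‖c (n + 1)‖ * (((n + 1 : ℕ) : ℝ) * ‖x‖ ^ n)
        ≤ ‖c (n + 1)‖ * (((n + 1 : ℕ) : ℝ) * r ^ n) := by gcongr
      _ = _ := by field_simp; ring
  rw [hsum.tsum_eq_zero_add] at key
  refine key.congr_deriv ?_
  simp only [Nat.cast_zero, zero_mul, mul_zero, zero_add]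
  refine tsum_congr fun n => ?_
  push_cast
  ring

lemma PolyBdd.continuousAt_ps {c : ℕ → ℂ} (h : PolyBdd c) {x : ℂ} (hx : ‖x‖ < 1) :
    ContinuousAt (ps c) x := (h.hasDerivAt hx).continuousAt

/-- The Euler operator `x * d/dx` multiplies the `n`-th coefficient by `n`. -/
lemma PolyBdd.hasDerivAt_div {c : ℕ → ℂ} (h : PolyBdd c) {x : ℝ} (hx0 : 0 < x) (hx : x < 1) :
    HasDerivAt (fun t : ℝ => ps c t) (ps (fun n => n * c n) x / x) x := by
  have hx' : ‖(x : ℂ)‖ < 1 := by simpa [abs_of_pos hx0] using hx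
  have hxc : (x : ℂ) ≠ 0 := by exact_mod_cast hx0.ne'
  convert (h.hasDerivAt hx').comp_ofReal using 1
  rw [ps, (h.natCast_mul.summable hx').tsum_eq_zero_add, div_eq_iff hxc, ← tsum_mul_right]
  simp only [Nat.cast_zero, zero_mul, zero_add]
  refine tsum_congr fun n => ?_
  push_cast
  ring

/-- Dividing by `1 - x` replaces the coefficients by their partial sums. -/
lemma one_sub_mul_tsum_partialSums {d : ℕ → ℂ} {x : ℂ}
    (hs : Summable fun n => (∑ m ∈ Finset.range (n + 1), d m) * x ^ n) :
    (1 - x) * ∑' n, (∑ m ∈ Finset.range (n + 1), d m) * x ^ n = ps d x := by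
  have hs' : Summable fun n => (∑ m ∈ Finset.range (n + 1), d m) * x ^ (n + 1) := by
    simpa [pow_succ, mul_assoc] using hs.mul_right x
  have h1 := (summable_nat_add_iff 1).mpr hs
  have h2 : ∀ n, (∑ m ∈ Finset.range (n + 1 + 1), d m) * x ^ (n + 1)
      - (∑ m ∈ Finset.range (n + 1), d m) * x ^ (n + 1) = d (n + 1) * x ^ (n + 1) := fun n => by
    rw [Finset.sum_range_succ _ (n + 1)]; ring
  have h3 : Summable fun n => d (n + 1) * x ^ (n + 1) := (h1.sub hs').congr h2
  have h4 : Summable fun n => d n * x ^ n := (summable_nat_add_iff 1).mp h3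
  have h5 : x * ∑' n, (∑ m ∈ Finset.range (n + 1), d m) * x ^ n
      = ∑' n, (∑ m ∈ Finset.range (n + 1), d m) * x ^ (n + 1) := by
    rw [← tsum_mul_left]
    exact tsum_congr fun n => by ring
  rw [sub_mul, one_mul, h5, hs.tsum_eq_zero_add, add_sub_assoc, ← h1.tsum_sub hs', ps,
    h4.tsum_eq_zero_add, tsum_congr h2]
  simp

/-- The operator `(1 - x) * d/dx` in terms of coefficients. -/
lemma PolyBdd.hasDerivAt_div_one_sub {c d : ℕ → ℂ} (h : PolyBdd c)
    (hcd : ∀ n : ℕ, n * c n = ∑ m ∈ Finset.range n, d m) {x : ℝ} (hx0 : 0 < x) (hx : x < 1) :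
    HasDerivAt (fun t : ℝ => ps c t) (ps d x / (1 - x)) x := by
  have hx' : ‖(x : ℂ)‖ < 1 := by simpa [abs_of_pos hx0] using hx
  have hxc : (1 - x : ℂ) ≠ 0 := by
    rw [sub_ne_zero]; exact_mod_cast hx.ne'
  have hxc0 : (x : ℂ) ≠ 0 := by exact_mod_cast hx0.ne'
  have hterm : ∀ n : ℕ, ((n : ℂ) + 1) * c (n + 1) = ∑ m ∈ Finset.range (n + 1), d m := fun n => by
    simpa using hcd (n + 1)
  convert (h.hasDerivAt hx').comp_ofReal using 1
  rw [div_eq_iff hxc, mul_comm]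
  simp only [hterm]
  refine (one_sub_mul_tsum_partialSums ?_).symm
  have h1 := ((summable_nat_add_iff 1).mpr (h.natCast_mul.summable hx')).mul_right (x : ℂ)⁻¹
  refine h1.congr fun n => ?_
  rw [← hterm]
  push_cast
  field_simp
  ring

/-- An absolutely convergent power series is continuous up to the boundary. -/
lemma continuousOn_ps {c : ℕ → ℂ} (h : Summable fun n => ‖c n‖) :
    ContinuousOn (fun t : ℝ => ps c t) (Set.Icc 0 1) := by
  refine continuousOn_tsum (fun n => by fun_prop) h fun n x hx => ?_
  rw [norm_mul, norm_pow, Complex.norm_real, Real.norm_eq_abs, abs_of_nonneg hx.1]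
  exact mul_le_of_le_one_right (norm_nonneg _) (pow_le_one₀ hx.1 hx.2)

/-! ### The hypergeometric functions as power series -/

/-- The partial product `∏_{k=1}^n (1 - z² / k²)`. -/
noncomputable def eulerProd (z : ℂ) (n : ℕ) : ℂ :=
  ∏ k ∈ Finset.range n, (1 - z ^ 2 / ((k : ℂ) + 1) ^ 2)

/-- The coefficients of `F(z, -z; 1; x)`. -/
noncomputable def coeffY₁ (z : ℂ) : ℕ → ℂ
  | 0 => 1
  | n + 1 => -z ^ 2 / ((n : ℂ) + 1) ^ 2 * eulerProd z n

/-- The coefficients of the power series in `w` of `w F(1 + z, 1 - z; 2; w)`, so that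
`Y₂ x z` is its value at `w = 1 - x`. -/
noncomputable def coeffY₂ (z : ℂ) : ℕ → ℂ
  | 0 => 0
  | n + 1 => eulerProd z n / ((n : ℂ) + 1)

lemma eulerProd_succ (z : ℂ) (n : ℕ) :
    eulerProd z (n + 1) = eulerProd z n * (1 - z ^ 2 / ((n : ℂ) + 1) ^ 2) :=
  Finset.prod_range_succ _ _

lemma sum_coeffY₁ (z : ℂ) (n : ℕ) :
    ∑ m ∈ Finset.range (n + 1), coeffY₁ z m = eulerProd z n := by
  induction n with
  | zero => simp [coeffY₁, eulerProd]
  | succ n ih => rw [Finset.sum_range_succ, ih, eulerProd_succ, coeffY₁]; ring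

lemma natCast_mul_coeffY₁ (z : ℂ) (n : ℕ) : n * coeffY₁ z n = -z ^ 2 * coeffY₂ z n := by
  rcases n with _ | n
  · simp [coeffY₂]
  have : (n : ℂ) + 1 ≠ 0 := by exact_mod_cast n.succ_ne_zero
  simp only [coeffY₁, coeffY₂]
  push_cast
  field_simp

lemma natCast_mul_coeffY₂ (z : ℂ) (n : ℕ) :
    n * coeffY₂ z n = ∑ m ∈ Finset.range n, coeffY₁ z m := by
  rcases n with _ | n
  · simp
  have : (n : ℂ) + 1 ≠ 0 := by exact_mod_cast n.succ_ne_zero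
  rw [sum_coeffY₁, coeffY₂]
  push_cast
  field_simp

lemma ascPochhammer_one_add_mul_one_sub (z : ℂ) (n : ℕ) :
    (ascPochhammer ℂ n).eval (1 + z) * (ascPochhammer ℂ n).eval (1 - z)
      = (n.factorial : ℂ) ^ 2 * eulerProd z n := by
  induction n with
  | zero => simp [eulerProd]
  | succ n ih =>
    have : (n : ℂ) + 1 ≠ 0 := by exact_mod_cast n.succ_ne_zero
    rw [ascPochhammer_succ_eval, ascPochhammer_succ_eval, mul_mul_mul_comm, ih, eulerProd_succ,
      Nat.factorial_succ]
    push_cast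
    field_simp
    ring

lemma ascPochhammer_mul_neg (z : ℂ) (n : ℕ) :
    (ascPochhammer ℂ (n + 1)).eval z * (ascPochhammer ℂ (n + 1)).eval (-z)
      = -z ^ 2 * ((n.factorial : ℂ) ^ 2 * eulerProd z n) := by
  rw [← ascPochhammer_one_add_mul_one_sub]
  induction n with
  | zero => simp; ring
  | succ n ih =>
    rw [ascPochhammer_succ_eval, ascPochhammer_succ_eval (n + 1), mul_mul_mul_comm, ih,
      ascPochhammer_succ_eval n, ascPochhammer_succ_eval n]
    push_cast
    ring

lemma ascPochhammer_eval_two (n : ℕ) :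
    (ascPochhammer ℂ n).eval 2 = ((n + 1).factorial : ℂ) := by
  induction n with
  | zero => simp
  | succ n ih =>
    rw [ascPochhammer_succ_eval, ih, Nat.factorial_succ (n + 1)]
    push_cast
    ring

lemma Y₁_eq_ps (x z : ℂ) : Y₁ x z = ps (coeffY₁ z) x := by
  rw [Y₁, ordinaryHypergeometric_eq_tsum, ps]
  refine tsum_congr fun n => ?_
  rw [smul_eq_mul]
  congr 1
  rcases n with _ | n
  · simp [coeffY₁]
  have h1 : (n : ℂ) + 1 ≠ 0 := by exact_mod_cast n.succ_ne_zero
  have h2 : (n.factorial : ℂ) ≠ 0 := by exact_mod_cast n.factorial_ne_zero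
  rw [mul_assoc (Nat.factorial _ : ℂ)⁻¹, ascPochhammer_mul_neg, ascPochhammer_eval_one, coeffY₁,
    Nat.factorial_succ]
  push_cast
  field_simp

lemma Y₂_eq_ps (x z : ℂ) (h : Summable fun n => coeffY₂ z n * (1 - x) ^ n) :
    Y₂ x z = ps (coeffY₂ z) (1 - x) := by
  rw [Y₂, ordinaryHypergeometric_eq_tsum, ps, h.tsum_eq_zero_add, ← tsum_mul_left]
  simp only [coeffY₂, zero_mul, zero_add]
  refine tsum_congr fun n => ?_
  have h1 : (n : ℂ) + 1 ≠ 0 := by exact_mod_cast n.succ_ne_zero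
  have h2 : (n.factorial : ℂ) ≠ 0 := by exact_mod_cast n.factorial_ne_zero
  rw [smul_eq_mul, mul_assoc (Nat.factorial _ : ℂ)⁻¹, ascPochhammer_one_add_mul_one_sub,
    ascPochhammer_eval_two, Nat.factorial_succ]
  push_cast
  field_simp
  ring

/-! ### Bounds for the coefficients -/

lemma exists_eulerProd_bound (z : ℂ) : ∃ K : ℝ, 0 ≤ K ∧ ∀ n, ‖eulerProd z n‖ ≤ K := by
  have hs : Summable fun k : ℕ => ‖-(z ^ 2 / ((k : ℂ) + 1) ^ 2)‖ := by
    have := ((summable_nat_add_iff 1).mpr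
      (Real.summable_nat_pow_inv (p := 2).mpr one_lt_two)).mul_left (‖z‖ ^ 2)
    refine this.congr fun k => ?_
    rw [norm_neg, norm_div, norm_pow, norm_pow, div_eq_mul_inv]
    congr 3
    rw [← Complex.norm_natCast]; push_cast; rfl
  refine ⟨Real.exp (∑' k : ℕ, ‖-(z ^ 2 / ((k : ℂ) + 1) ^ 2)‖), (Real.exp_pos _).le, fun n => ?_⟩
  have h1 := Finset.norm_prod_one_add_sub_one_le (Finset.range n)
    fun k : ℕ => -(z ^ 2 / ((k : ℂ) + 1) ^ 2)
  have h2 := norm_le_norm_sub_add (∏ k ∈ Finset.range n, (1 + -(z ^ 2 / ((k : ℂ) + 1) ^ 2))) 1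
  have h3 : Real.exp (∑ k ∈ Finset.range n, ‖-(z ^ 2 / ((k : ℂ) + 1) ^ 2)‖)
      ≤ Real.exp (∑' k : ℕ, ‖-(z ^ 2 / ((k : ℂ) + 1) ^ 2)‖) :=
    Real.exp_le_exp.mpr (hs.sum_le_tsum _ fun _ _ => norm_nonneg _)
  rw [norm_one] at h2
  simp only [eulerProd, sub_eq_add_neg] at h1 h2 ⊢
  linarith

lemma exists_coeffY₁_bound (z : ℂ) :
    ∃ K : ℝ, 0 ≤ K ∧ ∀ n : ℕ, ‖coeffY₁ z (n + 1)‖ ≤ K * (((n + 1 : ℕ) : ℝ) ^ 2)⁻¹ := by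
  obtain ⟨K, hK0, hK⟩ := exists_eulerProd_bound z
  refine ⟨‖z‖ ^ 2 * K, by positivity, fun n => ?_⟩
  have : ‖(n : ℂ) + 1‖ = ((n + 1 : ℕ) : ℝ) := by
    rw [← Complex.norm_natCast]; push_cast; rfl
  rw [coeffY₁, norm_mul, norm_div, norm_neg, norm_pow, norm_pow, this, div_eq_mul_inv,
    mul_right_comm]
  gcongr
  exact hK n

lemma summable_norm_coeffY₁ (z : ℂ) : Summable fun n => ‖coeffY₁ z n‖ := by
  obtain ⟨K, -, hK⟩ := exists_coeffY₁_bound z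
  refine (summable_nat_add_iff 1).mp (Summable.of_nonneg_of_le (fun _ => norm_nonneg _) hK ?_)
  exact ((summable_nat_add_iff 1).mpr
    (Real.summable_nat_pow_inv (p := 2).mpr one_lt_two)).mul_left K

lemma polyBdd_coeffY₁ (z : ℂ) : PolyBdd (coeffY₁ z) :=
  .of_bounded _ fun n => (summable_norm_coeffY₁ z).le_tsum n fun _ _ => norm_nonneg _

lemma polyBdd_coeffY₂ (z : ℂ) : PolyBdd (coeffY₂ z) := by
  obtain ⟨K, hK0, hK⟩ := exists_eulerProd_bound z
  refine .of_bounded K fun n => ?_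
  rcases n with _ | n
  · simpa [coeffY₂] using hK0
  have : ‖(n : ℂ) + 1‖ = ((n + 1 : ℕ) : ℝ) := by
    rw [← Complex.norm_natCast]; push_cast; rfl
  rw [coeffY₂, norm_div, this]
  refine (div_le_self (norm_nonneg _) ?_).trans (hK n)
  exact_mod_cast n.succ_pos

lemma Y₁_one_eq_tsum (z : ℂ) : Y₁ 1 z = ∑' n, coeffY₁ z n := by simp [Y₁_eq_ps, ps]

lemma tendsto_eulerProd (z : ℂ) : Tendsto (eulerProd z) atTop (𝓝 (Y₁ 1 z)) := by
  have := (summable_norm_coeffY₁ z).of_norm.hasSum.tendsto_sum_nat.comp (tendsto_add_atTop_nat 1)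
  rw [Y₁_one_eq_tsum]
  exact this.congr fun n => sum_coeffY₁ z n

/-- The rate of convergence of the product `∏ (1 - z² / k²)`. -/
lemma exists_eulerProd_sub_bound (z : ℂ) :
    ∃ K : ℝ, 0 ≤ K ∧ ∀ n : ℕ, ‖eulerProd z n - Y₁ 1 z‖ ≤ K / ((n : ℝ) + 1) := by
  obtain ⟨K, hK0, hK⟩ := exists_coeffY₁_bound z
  refine ⟨K * 2, by positivity, fun n => ?_⟩
  have h : ∀ m, n ≤ m → ‖eulerProd z n - eulerProd z m‖ ≤ K * 2 / ((n : ℝ) + 1) := fun m hm => by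
    have h1 : eulerProd z m - eulerProd z n = ∑ k ∈ Finset.Ioo n (m + 1), coeffY₁ z k := by
      rw [← sum_coeffY₁, ← sum_coeffY₁, ← Finset.sum_Ico_eq_sub _ (by omega)]
      rfl
    rw [norm_sub_rev, h1]
    refine (norm_sum_le _ _).trans ?_
    calc ∑ k ∈ Finset.Ioo n (m + 1), ‖coeffY₁ z k‖
        ≤ ∑ k ∈ Finset.Ioo n (m + 1), K * ((k : ℝ) ^ 2)⁻¹ := by
          refine Finset.sum_le_sum fun k hk => ?_
          obtain ⟨j, rfl⟩ : ∃ j, k = j + 1 :=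
            ⟨k - 1, by have := (Finset.mem_Ioo.mp hk).1; omega⟩
          exact hK j
      _ ≤ K * (2 / ((n : ℝ) + 1)) := by
          rw [← Finset.mul_sum]
          exact mul_le_mul_of_nonneg_left (sum_Ioo_inv_sq_le n (m + 1)) hK0
      _ = _ := by ring
  refine le_of_tendsto ((tendsto_const_nhds.sub (tendsto_eulerProd z)).norm) ?_
  filter_upwards [eventually_ge_atTop n] with m hm using h m hm

/-! ### Gauss's evaluation of `F(z, -z; c; 1)` and its derivative at `c = 1` -/

/-- The ratio `(1)_n / (c)_n` of Pochhammer symbols. -/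
noncomputable def pochRatio (c : ℝ) (n : ℕ) : ℝ :=
  ∏ k ∈ Finset.range n, ((k : ℝ) + 1) / (c + k)

/-- The value `F(z, -z; c; 1)`, for real `c ≥ 1`: the coefficients of `F(z, -z; 1; x)` are
multiplied by `(1)_n / (c)_n`. -/
noncomputable def gaussSum (z : ℂ) (c : ℝ) : ℂ := ∑' n, coeffY₁ z n * pochRatio c n

lemma pochRatio_succ (c : ℝ) (n : ℕ) :
    pochRatio c (n + 1) = pochRatio c n * (((n : ℝ) + 1) / (c + n)) :=
  Finset.prod_range_succ _ _

lemma pochRatio_nonneg {c : ℝ} (hc : 1 ≤ c) (n : ℕ) : 0 ≤ pochRatio c n :=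
  Finset.prod_nonneg fun k _ => by positivity

lemma pochRatio_le_one {c : ℝ} (hc : 1 ≤ c) (n : ℕ) : pochRatio c n ≤ 1 :=
  Finset.prod_le_one (fun k _ => by positivity) fun k _ =>
    (div_le_one (by positivity)).mpr (by linarith)

lemma norm_pochRatio_le_one {c : ℝ} (hc : 1 ≤ c) (n : ℕ) : ‖(pochRatio c n : ℂ)‖ ≤ 1 := by
  rw [Complex.norm_real, Real.norm_of_nonneg (pochRatio_nonneg hc n)]
  exact pochRatio_le_one hc n

lemma pochRatio_one (n : ℕ) : pochRatio 1 n = 1 :=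
  Finset.prod_eq_one fun k _ => by rw [add_comm, div_self]; positivity

lemma pochRatio_add_one {c : ℝ} (hc : 1 ≤ c) (n : ℕ) :
    pochRatio (c + 1) n * (c + n) = pochRatio c n * c := by
  induction n with
  | zero => simp [pochRatio]
  | succ n ih =>
    have h1 : c + n ≠ 0 := by positivity
    have h2 : c + 1 + n ≠ 0 := by positivity
    rw [pochRatio_succ, pochRatio_succ, mul_right_comm (pochRatio c n), ← ih]
    push_cast
    field_simp
    ring

lemma coeffY₁_succ (z : ℂ) (n : ℕ) :
    ((n : ℂ) + 1) ^ 2 * coeffY₁ z (n + 1) = ((n : ℂ) ^ 2 - z ^ 2) * coeffY₁ z n := by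
  have h : ∀ n : ℕ, (n : ℂ) + 1 ≠ 0 := fun n => by exact_mod_cast n.succ_ne_zero
  have h1 := h n
  rcases n with _ | n
  · simp [coeffY₁, eulerProd]
  have h0 := h n
  rw [coeffY₁, coeffY₁, eulerProd_succ]
  push_cast at h1 ⊢
  field_simp

lemma summable_norm_gaussSum (z : ℂ) {c : ℝ} (hc : 1 ≤ c) :
    Summable fun n => ‖coeffY₁ z n * pochRatio c n‖ :=
  (summable_norm_coeffY₁ z).of_nonneg_of_le (fun _ => norm_nonneg _) fun n => by
    rw [norm_mul]
    exact mul_le_of_le_one_right (norm_nonneg _) (norm_pochRatio_le_one hc n)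

lemma gaussSum_one (z : ℂ) : gaussSum z 1 = Y₁ 1 z := by
  simp [gaussSum, pochRatio_one, Y₁_one_eq_tsum]

/-- The contiguous relation between the parameters `c` and `c + 1`, in telescoped form: with
`t n = (z)_n (-z)_n / ((c)_n n!)`, the summand on the left is the difference
`g (n + 1) - g n` for `g n = -c n (t n)`. -/
lemma sum_contiguous (z : ℂ) {c : ℝ} (hc : 1 ≤ c) (N : ℕ) :
    ∑ n ∈ Finset.range N, ((c : ℂ) ^ 2 * (coeffY₁ z n * pochRatio c n)
      - ((c : ℂ) ^ 2 - z ^ 2) * (coeffY₁ z n * pochRatio (c + 1) n))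
      = -c * ((N * coeffY₁ z N) * pochRatio c N) := by
  induction N with
  | zero => simp
  | succ n ih =>
    have h1 : (c : ℂ) + n ≠ 0 := by
      have : c + n ≠ 0 := by positivity
      exact_mod_cast this
    have h2 : (n : ℂ) + 1 ≠ 0 := by exact_mod_cast n.succ_ne_zero
    have h3 : (pochRatio (c + 1) n : ℂ) = pochRatio c n * c / (c + n) := by
      rw [eq_div_iff h1]; exact_mod_cast pochRatio_add_one hc n
    have h4 : coeffY₁ z (n + 1)
        = ((n : ℂ) ^ 2 - z ^ 2) * coeffY₁ z n / ((n : ℂ) + 1) ^ 2 := by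
      rw [eq_div_iff (pow_ne_zero 2 h2), ← coeffY₁_succ]; ring
    rw [Finset.sum_range_succ, ih, pochRatio_succ, h3, h4]
    push_cast
    field_simp
    ring

lemma tendsto_natCast_mul_coeffY₁ (z : ℂ) :
    Tendsto (fun n : ℕ => (n : ℂ) * coeffY₁ z n) atTop (𝓝 0) := by
  rw [← tendsto_add_atTop_iff_nat 1]
  have h := (tendsto_eulerProd z).mul
    ((tendsto_one_div_add_atTop_nhds_zero_nat (𝕜 := ℂ)).const_mul (-z ^ 2))
  rw [mul_zero, mul_zero] at h
  refine h.congr fun n => ?_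
  rw [natCast_mul_coeffY₁, coeffY₂]
  ring

lemma gaussSum_contiguous (z : ℂ) {c : ℝ} (hc : 1 ≤ c) :
    gaussSum z c = (1 - z ^ 2 / (c : ℂ) ^ 2) * gaussSum z (c + 1) := by
  have hc0 : (c : ℂ) ≠ 0 := by exact_mod_cast (by positivity : c ≠ 0)
  have h1 := ((summable_norm_gaussSum z hc).of_norm.hasSum.mul_left ((c : ℂ) ^ 2)).sub
    ((summable_norm_gaussSum z (c := c + 1) (by linarith)).of_norm.hasSum.mul_left
      ((c : ℂ) ^ 2 - z ^ 2))
  have h2 := h1.tendsto_sum_nat.congr (sum_contiguous z hc)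
  have h3 : Tendsto (fun N : ℕ => -(c : ℂ) * ((N * coeffY₁ z N) * pochRatio c N)) atTop (𝓝 0) := by
    rw [← mul_zero (-(c : ℂ))]
    refine Tendsto.const_mul _ (squeeze_zero_norm (fun N => ?_)
      (tendsto_zero_iff_norm_tendsto_zero.mp (tendsto_natCast_mul_coeffY₁ z)))
    rw [norm_mul]
    exact mul_le_of_le_one_right (norm_nonneg _) (norm_pochRatio_le_one hc N)
  have h4 := tendsto_nhds_unique h2 h3
  change (c : ℂ) ^ 2 * gaussSum z c - ((c : ℂ) ^ 2 - z ^ 2) * gaussSum z (c + 1) = 0 at h4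
  field_simp
  linear_combination h4

lemma gaussSum_eq_prod_mul (z : ℂ) {c : ℝ} (hc : 1 ≤ c) (M : ℕ) :
    gaussSum z c = (∏ k ∈ Finset.range M, (1 - z ^ 2 / ((c : ℂ) + k) ^ 2)) * gaussSum z (c + M) := by
  induction M with
  | zero => simp
  | succ M ih =>
    have h : 1 ≤ c + M := by linarith [M.cast_nonneg (α := ℝ)]
    rw [ih, gaussSum_contiguous z h, Finset.prod_range_succ]
    push_cast
    rw [mul_assoc, add_assoc]

lemma tendsto_gaussSum_add (z : ℂ) {c : ℝ} (hc : 1 ≤ c) :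
    Tendsto (fun M : ℕ => gaussSum z (c + M)) atTop (𝓝 1) := by
  have key : Tendsto (fun M : ℕ => ∑' n, coeffY₁ z n * pochRatio (c + M) n) atTop
      (𝓝 (∑' n : ℕ, if n = 0 then (1 : ℂ) else 0)) := by
    refine tendsto_tsum_of_dominated_convergence (summable_norm_coeffY₁ z) (fun n => ?_)
      (Eventually.of_forall fun M n => ?_)
    · rcases n with _ | n
      · simp [coeffY₁, pochRatio]
      have h0 : Tendsto (fun M : ℕ => pochRatio (c + M) (n + 1)) atTop
          (𝓝 (∏ _k ∈ Finset.range (n + 1), 0)) := by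
        refine tendsto_finsetProd _ fun k _ => ?_
        refine tendsto_const_nhds.div_atTop (tendsto_atTop_add_const_right _ _ ?_)
        exact tendsto_atTop_add_const_left _ _ tendsto_natCast_atTop_atTop
      have h1 := ((Complex.continuous_ofReal.tendsto _).comp h0).const_mul (coeffY₁ z (n + 1))
      simpa using h1
    · rw [norm_mul]
      refine mul_le_of_le_one_right (norm_nonneg _) (norm_pochRatio_le_one ?_ n)
      linarith [M.cast_nonneg (α := ℝ)]
  rwa [tsum_ite_eq] at key

/-- Gauss's summation theorem for `F(z, -z; c; 1)`. Iterating the contiguous relation gives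
`∏ (1 - z² / (c + k)²)`, which is a quotient of Euler's products for `Γ`. -/
lemma gaussSum_eq_Gamma (z : ℂ) {c : ℝ} (hc : 1 ≤ c) (h₁ : ∀ m : ℕ, (c : ℂ) - z ≠ -m)
    (h₂ : ∀ m : ℕ, (c : ℂ) + z ≠ -m) :
    gaussSum z c = Complex.Gamma c ^ 2 / (Complex.Gamma (c - z) * Complex.Gamma (c + z)) := by
  have hlim := ((Complex.GammaSeq_tendsto_Gamma c).pow 2).div
    ((Complex.GammaSeq_tendsto_Gamma (c - z)).mul (Complex.GammaSeq_tendsto_Gamma (c + z)))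
    (mul_ne_zero (Complex.Gamma_ne_zero h₁) (Complex.Gamma_ne_zero h₂))
  have hprod : Tendsto (fun M : ℕ => ∏ k ∈ Finset.range (M + 1), (1 - z ^ 2 / ((c : ℂ) + k) ^ 2))
      atTop (𝓝 (Complex.Gamma c ^ 2 / (Complex.Gamma (c - z) * Complex.Gamma (c + z)))) := by
    refine hlim.congr' ?_
    filter_upwards [eventually_ne_atTop 0] with M hM
    have hM' : (M : ℂ) ≠ 0 := by exact_mod_cast hM
    have hA : ∏ j ∈ Finset.range (M + 1), ((c : ℂ) + j) ≠ 0 :=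
      Finset.prod_ne_zero_iff.mpr fun j _ => by
        exact_mod_cast (by positivity : c + j ≠ 0)
    have hB : ∏ j ∈ Finset.range (M + 1), ((c : ℂ) - z + j) ≠ 0 :=
      Finset.prod_ne_zero_iff.mpr fun j _ h => h₁ j (eq_neg_of_add_eq_zero_left h)
    have hC : ∏ j ∈ Finset.range (M + 1), ((c : ℂ) + z + j) ≠ 0 :=
      Finset.prod_ne_zero_iff.mpr fun j _ h => h₂ j (eq_neg_of_add_eq_zero_left h)
    have hfac : ∏ k ∈ Finset.range (M + 1), (1 - z ^ 2 / ((c : ℂ) + k) ^ 2)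
        = (∏ j ∈ Finset.range (M + 1), ((c : ℂ) - z + j))
          * (∏ j ∈ Finset.range (M + 1), ((c : ℂ) + z + j))
          / (∏ j ∈ Finset.range (M + 1), ((c : ℂ) + j)) ^ 2 := by
      rw [← Finset.prod_mul_distrib, ← Finset.prod_pow, ← Finset.prod_div_distrib]
      refine Finset.prod_congr rfl fun k _ => ?_
      have : (c : ℂ) + k ≠ 0 := by exact_mod_cast (by positivity : c + k ≠ 0)
      field_simp
      ring
    have hpow : (M : ℂ) ^ ((c : ℂ) - z) * (M : ℂ) ^ ((c : ℂ) + z) = ((M : ℂ) ^ (c : ℂ)) ^ 2 := by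
      rw [← Complex.cpow_add _ _ hM', sq, ← Complex.cpow_add _ _ hM']
      congr 1
      ring
    have hp0 : (M : ℂ) ^ (c : ℂ) ≠ 0 := by simp [Complex.cpow_eq_zero_iff, hM']
    have hf0 : (M.factorial : ℂ) ≠ 0 := by exact_mod_cast M.factorial_ne_zero
    simp only [Pi.div_apply, Complex.GammaSeq]
    rw [hfac, div_mul_div_comm, mul_mul_mul_comm, hpow]
    field_simp
  have h := hprod.mul ((tendsto_gaussSum_add z hc).comp (tendsto_add_atTop_nat 1))
  rw [mul_one] at h
  refine tendsto_nhds_unique (tendsto_const_nhds.congr fun M => ?_) h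
  exact gaussSum_eq_prod_mul z hc (M + 1)

/-- Abel summation applied to `F(z, -z; 1 + ε; 1) - F(z, -z; 1; 1)`. -/
lemma sum_gaussSum_abel (z : ℂ) {ε : ℝ} (hε : 0 < ε) (N : ℕ) :
    ∑ n ∈ Finset.range (N + 1), coeffY₁ z n * pochRatio (1 + ε) n = Y₁ 1 z
      + (eulerProd z N - Y₁ 1 z) * pochRatio (1 + ε) N
      + ε * ∑ n ∈ Finset.range N,
          (eulerProd z n - Y₁ 1 z) * pochRatio (1 + ε) n / ((n : ℂ) + 1 + ε) := by
  induction N with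
  | zero => simp [coeffY₁, pochRatio, eulerProd]
  | succ N ih =>
    have h1 : (N : ℂ) + 1 + ε ≠ 0 := by exact_mod_cast (by positivity : (N : ℝ) + 1 + ε ≠ 0)
    have h1' : (1 : ℂ) + ε + N ≠ 0 := by rwa [show (1 : ℂ) + ε + N = N + 1 + ε by ring]
    have h2 : coeffY₁ z (N + 1) = eulerProd z (N + 1) - eulerProd z N := by
      rw [← sum_coeffY₁, ← sum_coeffY₁, Finset.sum_range_succ _ (N + 1)]; ring
    rw [Finset.sum_range_succ, ih, Finset.sum_range_succ _ N, pochRatio_succ, h2]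
    push_cast
    rw [show (1 : ℂ) + ε + N = N + 1 + ε by ring]
    field_simp
    ring

/-- A bound, uniform in `ε`, for the terms of the sum produced by Abel summation. -/
lemma norm_abel_term_le (z : ℂ) : ∃ K : ℝ, ∀ ε : ℝ, 0 < ε → ∀ n : ℕ,
    ‖(eulerProd z n - Y₁ 1 z) * pochRatio (1 + ε) n / ((n : ℂ) + 1 + ε)‖
      ≤ K * (((n + 1 : ℕ) : ℝ) ^ 2)⁻¹ := by
  obtain ⟨K, hK0, hK⟩ := exists_eulerProd_sub_bound z
  refine ⟨K, fun ε hε n => ?_⟩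
  have h1 : ‖(n : ℂ) + 1 + ε‖ = (n : ℝ) + 1 + ε := by
    have : ((n : ℂ) + 1 + ε) = ((n + 1 + ε : ℝ) : ℂ) := by push_cast; rfl
    rw [this, Complex.norm_real, Real.norm_of_nonneg (by positivity)]
  rw [norm_div, norm_mul, h1]
  calc ‖eulerProd z n - Y₁ 1 z‖ * ‖(pochRatio (1 + ε) n : ℂ)‖ / ((n : ℝ) + 1 + ε)
      ≤ K / ((n : ℝ) + 1) * 1 / ((n : ℝ) + 1) := by
        refine div_le_div₀ (by positivity) ?_ (by positivity) (by linarith)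
        exact mul_le_mul (hK n) (norm_pochRatio_le_one (by linarith) n) (norm_nonneg _)
          (by positivity)
    _ = _ := by push_cast; field_simp

lemma summable_inv_succ_sq : Summable fun n : ℕ => (((n + 1 : ℕ) : ℝ) ^ 2)⁻¹ :=
  (summable_nat_add_iff 1).mpr (Real.summable_nat_pow_inv (p := 2).mpr one_lt_two)

lemma gaussSum_sub (z : ℂ) {ε : ℝ} (hε : 0 < ε) :
    gaussSum z (1 + ε) - Y₁ 1 z = ε * ∑' n : ℕ,
      (eulerProd z n - Y₁ 1 z) * pochRatio (1 + ε) n / ((n : ℂ) + 1 + ε) := by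
  obtain ⟨K, hK⟩ := norm_abel_term_le z
  have hs := Summable.of_norm_bounded (summable_inv_succ_sq.mul_left K) (hK ε hε)
  have hc : 1 ≤ 1 + ε := by linarith
  have h1 := (summable_norm_gaussSum z hc).of_norm.hasSum.tendsto_sum_nat.comp
    (tendsto_add_atTop_nat 1)
  have h0 : Tendsto (fun N => (eulerProd z N - Y₁ 1 z) * pochRatio (1 + ε) N) atTop (𝓝 0) := by
    refine squeeze_zero_norm (fun N => ?_) (tendsto_iff_norm_sub_tendsto_zero.mp
      (tendsto_eulerProd z))
    rw [norm_mul]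
    exact mul_le_of_le_one_right (norm_nonneg _) (norm_pochRatio_le_one hc N)
  have h2 := ((tendsto_const_nhds (x := Y₁ 1 z)).add h0).add
    (hs.hasSum.tendsto_sum_nat.const_mul (ε : ℂ))
  have h3 := tendsto_nhds_unique (h1.congr fun N => sum_gaussSum_abel z hε N) h2
  change gaussSum z (1 + ε) = _ at h3
  rw [h3]
  ring

/-- The derivative of `F(z, -z; c; 1)` with respect to `c` at `c = 1`, as a series. -/
lemma tendsto_gaussSum_slope (z : ℂ) :
    Tendsto (fun ε : ℝ => (ε : ℂ)⁻¹ * (gaussSum z (1 + ε) - Y₁ 1 z)) (𝓝[>] 0)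
      (𝓝 (∑' n : ℕ, (eulerProd z n - Y₁ 1 z) / ((n : ℂ) + 1))) := by
  obtain ⟨K, hK⟩ := norm_abel_term_le z
  have key : Tendsto (fun ε : ℝ => ∑' n : ℕ,
      (eulerProd z n - Y₁ 1 z) * pochRatio (1 + ε) n / ((n : ℂ) + 1 + ε)) (𝓝[>] 0)
      (𝓝 (∑' n : ℕ, (eulerProd z n - Y₁ 1 z) / ((n : ℂ) + 1))) := by
    refine tendsto_tsum_of_dominated_convergence (summable_inv_succ_sq.mul_left K) (fun n => ?_) ?_
    · have hn : (n : ℂ) + 1 ≠ 0 := by exact_mod_cast n.succ_ne_zero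
      have h1 : ContinuousAt (fun ε : ℝ => pochRatio (1 + ε) n) 0 := by
        unfold pochRatio
        refine tendsto_finsetProd _ fun k _ => ?_
        refine ContinuousAt.div (by fun_prop) (by fun_prop) ?_
        positivity
      have h2 : ContinuousAt (fun ε : ℝ =>
          (eulerProd z n - Y₁ 1 z) * pochRatio (1 + ε) n / ((n : ℂ) + 1 + ε)) 0 := by
        refine ContinuousAt.div (continuousAt_const.mul
          (Complex.continuous_ofReal.continuousAt.comp h1)) (by fun_prop) (by simpa using hn)
      have h3 := h2.tendsto
      simp only [add_zero, pochRatio_one, Complex.ofReal_one, mul_one, Complex.ofReal_zero] at h3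
      exact h3.mono_left nhdsWithin_le_nhds
    · filter_upwards [self_mem_nhdsWithin] with ε hε n using hK ε hε n
  refine key.congr' ?_
  filter_upwards [self_mem_nhdsWithin] with ε (hε : 0 < ε)
  rw [gaussSum_sub z hε, inv_mul_cancel_left₀]
  exact_mod_cast hε.ne'

lemma hasDerivAt_Gamma_digamma {s : ℂ} (hs : ∀ m : ℕ, s ≠ -m) :
    HasDerivAt Complex.Gamma (Complex.digamma s * Complex.Gamma s) s := by
  have h := (Complex.differentiableAt_Gamma s hs).hasDerivAt
  rwa [Complex.digamma_def, logDeriv_apply, div_mul_cancel₀ _ (Complex.Gamma_ne_zero hs)]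

lemma Y₁_one_eq_Gamma {z : ℂ} (h₁ : ∀ m : ℕ, 1 - z ≠ -m) (h₂ : ∀ m : ℕ, 1 + z ≠ -m) :
    Y₁ 1 z = 1 / (Complex.Gamma (1 - z) * Complex.Gamma (1 + z)) := by
  have := gaussSum_eq_Gamma z le_rfl (by simpa using h₁) (by simpa using h₂)
  simpa [gaussSum_one] using this

lemma Y₁_one_ne_zero {z : ℂ} (h₁ : ∀ m : ℕ, 1 - z ≠ -m) (h₂ : ∀ m : ℕ, 1 + z ≠ -m) :
    Y₁ 1 z ≠ 0 := by
  rw [Y₁_one_eq_Gamma h₁ h₂]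
  exact one_div_ne_zero (mul_ne_zero (Complex.Gamma_ne_zero h₁) (Complex.Gamma_ne_zero h₂))

/-- The constant in the logarithmic expansion of `Y₂` at `0`: both sides are the derivative of
`F(z, -z; c; 1)` with respect to `c` at `c = 1`. -/
lemma tsum_eulerProd_sub {z : ℂ} (h₁ : ∀ m : ℕ, 1 - z ≠ -m) (h₂ : ∀ m : ℕ, 1 + z ≠ -m) :
    ∑' n : ℕ, (eulerProd z n - Y₁ 1 z) / ((n : ℂ) + 1)
      = Y₁ 1 z * (2 * Complex.digamma 1 - Complex.digamma (1 - z) - Complex.digamma (1 + z)) := by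
  have hG₁ := Complex.Gamma_ne_zero h₁
  have hG₂ := Complex.Gamma_ne_zero h₂
  have h0 : ∀ m : ℕ, (1 : ℂ) ≠ -m := fun m h => by
    have := congrArg Complex.re h
    simp at this
    linarith [m.cast_nonneg (α := ℝ)]
  have d₁ := (hasDerivAt_Gamma_digamma h₁).comp_sub_const 1 z
  have d₂ := (hasDerivAt_Gamma_digamma h₂).comp_add_const 1 z
  have d := (((hasDerivAt_Gamma_digamma h0).pow 2).div (d₁.mul d₂) (mul_ne_zero hG₁ hG₂))
  have d' := (HasDerivAt.comp_ofReal (z := 1) (by simpa using d)).tendsto_slope_zero_right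
  -- `c ± z` stays away from the poles of `Γ` for `c` near `1`, so Gauss's theorem applies there
  have hev : ∀ᶠ ε : ℝ in 𝓝[>] 0, gaussSum z (1 + ε) = Complex.Gamma ((1 + ε : ℝ) : ℂ) ^ 2
      / (Complex.Gamma ((1 + ε : ℝ) - z) * Complex.Gamma ((1 + ε : ℝ) + z)) := by
    have c₁ : ContinuousAt (fun ε : ℝ => Complex.Gamma ((1 + ε : ℝ) - z)) 0 := by
      refine ContinuousAt.comp (g := Complex.Gamma) ?_ (by fun_prop)
      simpa using (Complex.continuousAt_Gamma _ h₁)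
    have c₂ : ContinuousAt (fun ε : ℝ => Complex.Gamma ((1 + ε : ℝ) + z)) 0 := by
      refine ContinuousAt.comp (g := Complex.Gamma) ?_ (by fun_prop)
      simpa using (Complex.continuousAt_Gamma _ h₂)
    filter_upwards [self_mem_nhdsWithin,
      nhdsWithin_le_nhds (c₁.eventually_ne (by simpa using hG₁)),
      nhdsWithin_le_nhds (c₂.eventually_ne (by simpa using hG₂))] with ε (hε : 0 < ε) e₁ e₂
    refine gaussSum_eq_Gamma z (by linarith) (fun m hm => e₁ ?_) (fun m hm => e₂ ?_)
    · exact (Complex.Gamma_eq_zero_iff _).mpr ⟨m, hm⟩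
    · exact (Complex.Gamma_eq_zero_iff _).mpr ⟨m, hm⟩
  have hslope := (tendsto_gaussSum_slope z).congr' (f₂ := fun ε : ℝ => (ε : ℂ)⁻¹ *
    (Complex.Gamma ((1 + ε : ℝ) : ℂ) ^ 2
      / (Complex.Gamma ((1 + ε : ℝ) - z) * Complex.Gamma ((1 + ε : ℝ) + z)) - Y₁ 1 z)) (by
    filter_upwards [hev] with ε hε
    rw [hε])
  have huniq := tendsto_nhds_unique hslope (d'.congr fun ε => by
    rw [Y₁_one_eq_Gamma h₁ h₂]
    simp [Complex.real_smul])
  rw [huniq, Y₁_one_eq_Gamma h₁ h₂]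
  field_simp
  ring

/-! ### The differential system -/

/-- The second-order equation `((1 - x) d/dx) (x d/dx) a = -w a` on `(0, 1)` as a first-order
system with `b = x a'`. For `w = z²` it is the hypergeometric equation satisfied by `Y₁ x z`
and `Y₂ x z`. -/
structure HypSystem (w : ℂ) (a b : ℝ → ℂ) : Prop where
  deriv_a : ∀ x, 0 < x → x < 1 → HasDerivAt a (b x / x) x
  deriv_b : ∀ x, 0 < x → x < 1 → HasDerivAt b (-w * a x / (1 - x)) x

/-- The fourth-order equation `((1 - x) d/dx)² (x d/dx)² T₀ = -4 w T₀` on `(0, 1)` as a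
first-order system. -/
structure QuarticSystem (w : ℂ) (T₀ T₁ T₂ T₃ : ℝ → ℂ) : Prop where
  deriv₀ : ∀ x, 0 < x → x < 1 → HasDerivAt T₀ (T₁ x / x) x
  deriv₁ : ∀ x, 0 < x → x < 1 → HasDerivAt T₁ (T₂ x / x) x
  deriv₂ : ∀ x, 0 < x → x < 1 → HasDerivAt T₂ (T₃ x / (1 - x)) x
  deriv₃ : ∀ x, 0 < x → x < 1 → HasDerivAt T₃ (-4 * w * T₀ x / (1 - x)) x

lemma QuarticSystem.const_mul {w : ℂ} {T₀ T₁ T₂ T₃ : ℝ → ℂ} (h : QuarticSystem w T₀ T₁ T₂ T₃)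
    (k : ℂ) : QuarticSystem w (fun x => k * T₀ x) (fun x => k * T₁ x) (fun x => k * T₂ x)
      (fun x => k * T₃ x) where
  deriv₀ x h0 h1 := ((h.deriv₀ x h0 h1).const_mul k).congr_deriv (by ring)
  deriv₁ x h0 h1 := ((h.deriv₁ x h0 h1).const_mul k).congr_deriv (by ring)
  deriv₂ x h0 h1 := ((h.deriv₂ x h0 h1).const_mul k).congr_deriv (by ring)
  deriv₃ x h0 h1 := ((h.deriv₃ x h0 h1).const_mul k).congr_deriv (by ring)

lemma QuarticSystem.sub {w : ℂ} {T₀ T₁ T₂ T₃ U₀ U₁ U₂ U₃ : ℝ → ℂ}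
    (h : QuarticSystem w T₀ T₁ T₂ T₃) (h' : QuarticSystem w U₀ U₁ U₂ U₃) :
    QuarticSystem w (fun x => T₀ x - U₀ x) (fun x => T₁ x - U₁ x) (fun x => T₂ x - U₂ x)
      (fun x => T₃ x - U₃ x) where
  deriv₀ x h0 h1 := ((h.deriv₀ x h0 h1).sub (h'.deriv₀ x h0 h1)).congr_deriv (by ring)
  deriv₁ x h0 h1 := ((h.deriv₁ x h0 h1).sub (h'.deriv₁ x h0 h1)).congr_deriv (by ring)
  deriv₂ x h0 h1 := ((h.deriv₂ x h0 h1).sub (h'.deriv₂ x h0 h1)).congr_deriv (by ring)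
  deriv₃ x h0 h1 := ((h.deriv₃ x h0 h1).sub (h'.deriv₃ x h0 h1)).congr_deriv (by ring)

/-- The product of solutions of the second-order equations with opposite parameters solves the
fourth-order equation. -/
lemma HypSystem.mul {w : ℂ} {a₁ b₁ a₂ b₂ : ℝ → ℂ} (h₁ : HypSystem w a₁ b₁)
    (h₂ : HypSystem (-w) a₂ b₂) :
    QuarticSystem (w ^ 2) (fun x => a₁ x * a₂ x) (fun x => b₁ x * a₂ x + a₁ x * b₂ x)
      (fun x => 2 * (b₁ x * b₂ x)) (fun x => 2 * w * (a₂ x * b₁ x - a₁ x * b₂ x)) := by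
  have hx : ∀ x : ℝ, 0 < x → (x : ℂ) ≠ 0 := fun x h => by exact_mod_cast h.ne'
  have hx' : ∀ x : ℝ, x < 1 → (1 - x : ℂ) ≠ 0 := fun x h => by
    rw [sub_ne_zero]; exact_mod_cast h.ne'
  constructor <;> intro x h0 h1 <;> have e0 := hx x h0 <;> have e1 := hx' x h1 <;>
    have da₁ := h₁.deriv_a x h0 h1 <;> have da₂ := h₂.deriv_a x h0 h1 <;>
    have db₁ := h₁.deriv_b x h0 h1 <;> have db₂ := h₂.deriv_b x h0 h1
  · exact (da₁.mul da₂).congr_deriv (by field_simp)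
  · exact ((db₁.mul da₂).add (da₁.mul db₂)).congr_deriv (by field_simp; ring)
  · exact ((db₁.mul db₂).const_mul 2).congr_deriv (by field_simp; ring)
  · exact (((da₂.mul db₁).sub (da₁.mul db₂)).const_mul (2 * w)).congr_deriv (by field_simp; ring)

/-- Integration from `0` of a power bound for the derivative. -/
lemma norm_le_of_norm_deriv_le {f f' : ℝ → ℂ} {a C : ℝ} {n : ℕ} (hC : 0 ≤ C)
    (hf : ∀ x, 0 < x → x ≤ a → HasDerivAt f (f' x) x) (h0 : Tendsto f (𝓝[>] 0) (𝓝 0))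
    (hf' : ∀ x, 0 < x → x ≤ a → ‖f' x‖ ≤ C * x ^ n) {x : ℝ} (hx : 0 < x) (hxa : x ≤ a) :
    ‖f x‖ ≤ C * x ^ (n + 1) / (n + 1) := by
  have hn : (n : ℝ) + 1 ≠ 0 := by positivity
  have key : ∀ ε, 0 < ε → ε < x → ‖f x - f ε‖ ≤ C * x ^ (n + 1) / (n + 1) := fun ε hε hεx => by
    have hB : ∀ t : ℝ, HasDerivAt (fun t => C * (t ^ (n + 1) - ε ^ (n + 1)) / (n + 1))
        (C * t ^ n) t := fun t => by
      refine ((((hasDerivAt_pow (n + 1) t).sub_const _).const_mul C).div_const _).congr_deriv ?_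
      push_cast
      field_simp
    have h := image_norm_le_of_norm_deriv_right_le_deriv_boundary (f := fun t => f t - f ε)
      (f' := f') (a := ε) (b := x)
      (fun t ht => ((hf t (hε.trans_le ht.1) (ht.2.trans hxa)).continuousAt.sub
        continuousAt_const).continuousWithinAt)
      (fun t ht => ((hf t (hε.trans_le ht.1) (ht.2.le.trans hxa)).sub_const _).hasDerivWithinAt)
      (by simp) hB (fun t ht => hf' t (hε.trans_le ht.1) (ht.2.le.trans hxa))
      (Set.right_mem_Icc.mpr hεx.le)
    refine h.trans ?_
    gcongr
    linarith [pow_pos hε (n + 1)]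
  have hlim := (tendsto_const_nhds (x := f x)).sub h0 |>.norm
  rw [sub_zero] at hlim
  refine le_of_tendsto hlim ?_
  filter_upwards [self_mem_nhdsWithin, nhdsWithin_le_nhds (Iio_mem_nhds hx)] with ε h1 h2
    using key ε h1 h2

lemma exists_norm_bound_Ioc {f : ℝ → ℂ} {a : ℝ} (hf : ∀ x, 0 < x → x ≤ a → ContinuousAt f x)
    (h0 : Tendsto f (𝓝[>] 0) (𝓝 0)) : ∃ M, 0 ≤ M ∧ ∀ x, 0 < x → x ≤ a → ‖f x‖ ≤ M := by
  have h1 : ∀ᶠ x in 𝓝[>] 0, ‖f x‖ < 1 := (by simpa using h0.norm :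
    Tendsto (fun x => ‖f x‖) (𝓝[>] 0) (𝓝 0)).eventually_lt_const one_pos
  obtain ⟨δ, hδ, h2⟩ := mem_nhdsGT_iff_exists_Ioo_subset.mp h1
  have hδ : 0 < δ := hδ
  obtain ⟨C, hC⟩ := isCompact_Icc.exists_bound_of_continuousOn (s := Set.Icc (δ / 2) a) (f := f)
    fun x hx => (hf x (by linarith [hx.1]) hx.2).continuousWithinAt
  refine ⟨max 1 C, by positivity, fun x hx hxa => ?_⟩
  rcases lt_or_ge x δ with h | h
  · exact (h2 ⟨hx, h⟩ : ‖f x‖ < 1).le.trans (le_max_left _ _)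
  · exact (hC x ⟨by linarith, hxa⟩).trans (le_max_right _ _)

/-- The only solution of the fourth-order system all of whose components vanish at `0` is zero.
One passage through the four equations turns a bound `‖T₃‖ ≤ M x ^ (2 k)` near `0` into a bound with
`2 k + 2` in place of `2 k` and a smaller constant. -/
lemma QuarticSystem.eq_zero {w : ℂ} {T₀ T₁ T₂ T₃ : ℝ → ℂ} (h : QuarticSystem w T₀ T₁ T₂ T₃)
    (h₀ : Tendsto T₀ (𝓝[>] 0) (𝓝 0)) (h₁ : Tendsto T₁ (𝓝[>] 0) (𝓝 0))
    (h₂ : Tendsto T₂ (𝓝[>] 0) (𝓝 0)) (h₃ : Tendsto T₃ (𝓝[>] 0) (𝓝 0)) {a : ℝ} (ha0 : 0 < a)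
    (ha1 : a < 1) : T₀ a = 0 := by
  obtain ⟨M, hM0, hM⟩ := exists_norm_bound_Ioc (a := a)
    (fun x hx hxa => (h.deriv₃ x hx (hxa.trans_lt ha1)).continuousAt) h₃
  set L : ℝ := (1 - a)⁻¹ with hL
  have hL0 : 0 < L := inv_pos.mpr (by linarith)
  have hdiv : ∀ (v : ℂ) (x : ℝ), 0 < x → x ≤ a → ‖v / (1 - x)‖ ≤ L * ‖v‖ := fun v x hx hxa => by
    have h1 : ‖(1 - x : ℂ)‖ = 1 - x := by
      rw [← Complex.ofReal_one, ← Complex.ofReal_sub, Complex.norm_real,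
        Real.norm_of_nonneg (by linarith)]
    rw [norm_div, h1, div_eq_inv_mul]
    have h2 : (1 - x)⁻¹ ≤ L := inv_anti₀ (by linarith) (by linarith)
    gcongr
  have hdivx : ∀ (v : ℂ) (C x : ℝ) (n : ℕ), 0 < x → ‖v‖ ≤ C * x ^ (n + 1) →
      ‖v / x‖ ≤ C * x ^ n := fun v C x n hx hv => by
    rw [norm_div, Complex.norm_real, Real.norm_of_nonneg hx.le, div_le_iff₀ hx]
    exact hv.trans_eq (by ring)
  have hweak : ∀ (C x : ℝ) (n : ℕ), 0 ≤ C → 0 < x →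
      C * x ^ (n + 1) / (n + 1) ≤ C * x ^ (n + 1) := fun C x n hC hx =>
    div_le_self (by positivity) (by linarith [n.cast_nonneg (α := ℝ)])
  -- one round of integration: from `T₃` to `T₂`, `T₁` and `T₀`
  have hdown : ∀ (C : ℝ) (n : ℕ), 0 ≤ C → (∀ x, 0 < x → x ≤ a → ‖T₃ x‖ ≤ C * x ^ n) →
      ∀ x, 0 < x → x ≤ a → ‖T₀ x‖ ≤ L * C * x ^ (n + 1) := fun C n hC hT₃ => by
    have hLC : 0 ≤ L * C := by positivity
    have hT₂ : ∀ x, 0 < x → x ≤ a → ‖T₂ x‖ ≤ L * C * x ^ (n + 1) := fun x hx hxa =>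
      (norm_le_of_norm_deriv_le hLC (fun x hx hxa => h.deriv₂ x hx (hxa.trans_lt ha1)) h₂
        (fun x hx hxa => (hdiv _ x hx hxa).trans (by
          rw [mul_assoc]; exact mul_le_mul_of_nonneg_left (hT₃ x hx hxa) hL0.le)) hx hxa).trans
        (hweak _ _ _ hLC hx)
    have hT₁ : ∀ x, 0 < x → x ≤ a → ‖T₁ x‖ ≤ L * C * x ^ (n + 1) := fun x hx hxa =>
      (norm_le_of_norm_deriv_le hLC (fun x hx hxa => h.deriv₁ x hx (hxa.trans_lt ha1)) h₁
        (fun x hx hxa => hdivx _ _ _ _ hx (hT₂ x hx hxa)) hx hxa).trans (hweak _ _ _ hLC hx)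
    exact fun x hx hxa =>
      (norm_le_of_norm_deriv_le hLC (fun x hx hxa => h.deriv₀ x hx (hxa.trans_lt ha1)) h₀
        (fun x hx hxa => hdivx _ _ _ _ hx (hT₁ x hx hxa)) hx hxa).trans (hweak _ _ _ hLC hx)
  set K : ℝ := 4 * ‖w‖ * L ^ 2 with hK
  have hK0 : 0 ≤ K := by positivity
  have hiter : ∀ k : ℕ, ∀ x, 0 < x → x ≤ a →
      ‖T₃ x‖ ≤ M * K ^ k / k.factorial * x ^ (2 * k) := fun k => by
    induction k with
    | zero => intro x hx hxa; simpa using hM x hx hxa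
    | succ k ih =>
      intro x hx hxa
      have hC : 0 ≤ M * K ^ k / k.factorial := by positivity
      have hT₀ := hdown _ _ hC ih
      refine (norm_le_of_norm_deriv_le (C := K * (M * K ^ k / k.factorial)) (n := 2 * k + 1)
        (by positivity) (fun x hx hxa => h.deriv₃ x hx (hxa.trans_lt ha1)) h₃
        (fun x hx hxa => (hdiv _ x hx hxa).trans ?_) hx hxa).trans ?_
      · rw [norm_mul, norm_mul, norm_neg, Complex.norm_ofNat]
        calc L * (4 * ‖w‖ * ‖T₀ x‖)
            ≤ L * (4 * ‖w‖ * (L * (M * K ^ k / k.factorial) * x ^ (2 * k + 1))) := by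
              gcongr; exact hT₀ x hx hxa
          _ = _ := by rw [hK]; ring
      · rw [Nat.factorial_succ]
        push_cast
        have hk : (k : ℝ) + 1 ≤ 2 * k + 1 + 1 := by linarith [k.cast_nonneg (α := ℝ)]
        calc K * (M * K ^ k / k.factorial) * x ^ (2 * k + 1 + 1) / (2 * (k : ℝ) + 1 + 1)
            ≤ K * (M * K ^ k / k.factorial) * x ^ (2 * k + 1 + 1) / ((k : ℝ) + 1) := by gcongr
          _ = _ := by field_simp; ring
  have hT₃ : ∀ x, 0 < x → x ≤ a → ‖T₃ x‖ ≤ 0 * x ^ 0 := fun x hx hxa => by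
    have hlim := (FloorSemiring.tendsto_pow_div_factorial_atTop (K * x ^ 2)).const_mul M
    rw [mul_zero] at hlim
    rw [zero_mul]
    refine ge_of_tendsto' hlim fun k => (hiter k x hx hxa).trans_eq ?_
    rw [mul_pow, ← pow_mul]
    ring
  have := hdown 0 0 le_rfl hT₃ a ha0 le_rfl
  simpa using this

/-! ### Multiple polylogarithms as power series -/

/-- The tuples `N = n 0 > n 1 > ⋯ > n k > 0`. -/
def decTuples : (k : ℕ) → ℕ → Finset (Fin (k + 1) → ℕ)
  | 0, N => if N = 0 then ∅ else {fun _ => N}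
  | k + 1, N => (Finset.range N).biUnion fun m => (decTuples k m).image (Matrix.vecCons N)

/-- The coefficient of `x ^ N` in `ζ_x(s)`, by recursion on the depth: the largest index is `N` and
the remaining ones form a tuple whose largest index is some `m < N`. -/
noncomputable def zetaCoeff : (k : ℕ) → (Fin (k + 1) → ℕ) → ℕ → ℝ
  | 0, s, N => if N = 0 then 0 else ((N : ℝ) ^ s 0)⁻¹
  | k + 1, s, N => ((N : ℝ) ^ s 0)⁻¹ * ∑ m ∈ Finset.range N, zetaCoeff k (Fin.tail s) m

lemma mem_decTuples {k N : ℕ} {f : Fin (k + 1) → ℕ} :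
    f ∈ decTuples k N ↔ f 0 = N ∧ StrictAnti f ∧ ∀ j, 0 < f j := by
  induction k generalizing N with
  | zero =>
    have : Subsingleton (Fin (0 + 1)) := inferInstanceAs (Subsingleton (Fin 1))
    have hs : StrictAnti f := Subsingleton.strictAnti f
    by_cases hN : N = 0
    · simp [decTuples, hN]
      intro h
      simp [h]
    · simp only [decTuples, hN, if_false, Finset.mem_singleton, hs, true_and]
      constructor
      · rintro rfl
        exact ⟨rfl, fun _ => Nat.pos_of_ne_zero hN⟩
      · rintro ⟨h, -⟩
        funext j
        rw [Subsingleton.elim j 0, h]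
  | succ k ih =>
    simp only [decTuples, Finset.mem_biUnion, Finset.mem_range, Finset.mem_image, ih]
    constructor
    · rintro ⟨m, hm, g, ⟨rfl, hg, hpos⟩, rfl⟩
      refine ⟨rfl, strictAnti_vecCons.mpr ⟨hm, hg⟩, fun j => ?_⟩
      refine Fin.cases ?_ (fun i => ?_) j
      · simpa using (hpos 0).trans hm
      · simpa using hpos i
    · rintro ⟨rfl, hf, hpos⟩
      refine ⟨f 1, hf (by simp), Matrix.vecTail f, ⟨rfl, ?_, fun j => hpos _⟩,
        Matrix.cons_head_tail f⟩
      exact hf.comp_strictMono (Fin.strictMono_succ)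

lemma sum_decTuples (k : ℕ) (s : Fin (k + 1) → ℕ) (N : ℕ) :
    ∑ f ∈ decTuples k N, ∏ j, ((f j : ℝ) ^ s j)⁻¹ = zetaCoeff k s N := by
  induction k generalizing N with
  | zero => by_cases hN : N = 0 <;> simp [decTuples, zetaCoeff, hN]
  | succ k ih =>
    rw [decTuples, Finset.sum_biUnion, zetaCoeff, Finset.mul_sum]
    · refine Finset.sum_congr rfl fun m _ => ?_
      rw [Finset.sum_image fun a _ b _ h => (Matrix.vecCons_inj.mp h).2, ← ih, Finset.mul_sum]
      refine Finset.sum_congr rfl fun f _ => ?_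
      rw [Fin.prod_univ_succ]
      simp [Fin.tail]
    · intro m _ m' _ hmm'
      refine Finset.disjoint_left.mpr fun f hf hf' => hmm' ?_
      obtain ⟨g, hg, rfl⟩ := Finset.mem_image.mp hf
      obtain ⟨g', hg', h⟩ := Finset.mem_image.mp hf'
      rw [← (mem_decTuples.mp hg).1, ← (mem_decTuples.mp hg').1, (Matrix.vecCons_inj.mp h).2]

/-- The terms of `ζ_x(s)` whose largest index is `N` sum to the degree `N` part. -/
lemma hasSum_fiber (x : ℝ) {k : ℕ} (s : Fin (k + 1) → ℕ) (N : ℕ) :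
    HasSum (fun n : {n : DecTuple (k + 1) // n.1 0 = N} => zetaTerm x s n.1)
      (zetaCoeff k s N * x ^ N) := by
  let e : {n : DecTuple (k + 1) // n.1 0 = N} ≃ {f // f ∈ decTuples k N} :=
    { toFun := fun n => ⟨n.1.1, mem_decTuples.mpr ⟨n.2, n.1.2⟩⟩
      invFun := fun f => ⟨⟨f.1, (mem_decTuples.mp f.2).2⟩, (mem_decTuples.mp f.2).1⟩
      left_inv := fun _ => rfl
      right_inv := fun _ => rfl }
  rw [← sum_decTuples, Finset.sum_mul]
  have h := e.hasSum_iff.mpr ((decTuples k N).hasSum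
    fun f => (∏ j, ((f j : ℝ) ^ s j)⁻¹) * x ^ N)
  refine h.congr_fun fun n => ?_
  simp only [Function.comp_apply, zetaTerm, n.2]
  exact mul_comm _ _

lemma zetaTerm_nonneg {x : ℝ} (hx : 0 ≤ x) {k : ℕ} (s : Fin (k + 1) → ℕ) (n : DecTuple (k + 1)) :
    0 ≤ zetaTerm x s n :=
  mul_nonneg (pow_nonneg hx _) (Finset.prod_nonneg fun _ _ => by positivity)

lemma summable_zetaTerm {x : ℝ} (hx : 0 ≤ x) {k : ℕ} {s : Fin (k + 1) → ℕ}
    (h : Summable fun N => zetaCoeff k s N * x ^ N) : Summable (zetaTerm x s) := by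
  let e := Equiv.sigmaFiberEquiv fun n : DecTuple (k + 1) => n.1 0
  refine e.summable_iff.mp ((summable_sigma_of_nonneg (f := zetaTerm x s ∘ e)
    fun _ => zetaTerm_nonneg hx _ _).mpr ⟨fun N => (hasSum_fiber x s N).summable, ?_⟩)
  exact h.congr fun N => (hasSum_fiber x s N).tsum_eq.symm

lemma zetaX_eq_tsum {x : ℝ} (hx : 0 ≤ x) {k : ℕ} {s : Fin (k + 1) → ℕ}
    (h : Summable fun N => zetaCoeff k s N * x ^ N) :
    zetaX x s = ∑' N, zetaCoeff k s N * x ^ N := by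
  let e := Equiv.sigmaFiberEquiv fun n : DecTuple (k + 1) => n.1 0
  have h1 := e.hasSum_iff.mpr (summable_zetaTerm hx h).hasSum
  exact (HasSum.sigma h1 fun N => hasSum_fiber x s N).tsum_eq.symm

/-! ### The coefficients of `ζ_x(3, {1, 3}^n)` -/

/-- The coefficient of `x ^ N` in `ζ_x(3, {1, 3}^n)`. -/
noncomputable def coeff313 (n N : ℕ) : ℝ := zetaCoeff (2 * n) (args313 n) N

-- At `N = 0` both sides vanish, the right-hand one because `0⁻¹ = 0`.
lemma coeff313_zero (N : ℕ) : coeff313 0 N = ((N : ℝ) ^ 3)⁻¹ := by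
  by_cases hN : N = 0 <;> simp [coeff313, zetaCoeff, args313, hN]

lemma coeff313_succ (n N : ℕ) : coeff313 (n + 1) N = ((N : ℝ) ^ 3)⁻¹ *
    ∑ m ∈ Finset.range N, (m : ℝ)⁻¹ * ∑ l ∈ Finset.range m, coeff313 n l := by
  have htail : Fin.tail (Fin.tail (args313 (n + 1))) = args313 n := by
    funext j
    have : Even ((j : ℕ) + 1 + 1) ↔ Even (j : ℕ) := by simp [Nat.even_add_one]
    simp [Fin.tail, args313, this]
  have h : coeff313 (n + 1) N = ((N : ℝ) ^ args313 (n + 1) 0)⁻¹ *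
      ∑ m ∈ Finset.range N, ((m : ℝ) ^ Fin.tail (args313 (n + 1)) 0)⁻¹ *
        ∑ l ∈ Finset.range m, zetaCoeff (2 * n) (Fin.tail (Fin.tail (args313 (n + 1)))) l := rfl
  have h0 : args313 (n + 1) 0 = 3 := by simp [args313]
  have h1 : Fin.tail (args313 (n + 1)) 0 = 1 := by
    simp only [Fin.tail, args313, Fin.val_succ]
    simp
  rw [h, htail, h0, h1]
  simp [coeff313]

lemma coeff313_nonneg (n N : ℕ) : 0 ≤ coeff313 n N := by
  induction n generalizing N with
  | zero => rw [coeff313_zero]; positivity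
  | succ n ih =>
    rw [coeff313_succ]
    exact mul_nonneg (by positivity) (Finset.sum_nonneg fun m _ =>
      mul_nonneg (by positivity) (Finset.sum_nonneg fun l _ => ih l))

lemma coeff313_zero_right (n : ℕ) : coeff313 n 0 = 0 := by
  cases n <;> simp [coeff313_zero, coeff313_succ]

lemma coeff313_zero_le (N : ℕ) : coeff313 0 N ≤ ((N : ℝ) ^ 2)⁻¹ := by
  rcases N with _ | N
  · simp [coeff313_zero]
  rw [coeff313_zero]
  have : (1 : ℝ) ≤ ((N + 1 : ℕ) : ℝ) := by exact_mod_cast N.succ_pos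
  exact inv_anti₀ (by positivity) (pow_le_pow_right₀ this (by norm_num))

/-- A pair `N ^ (-3) * m ^ (-1)` of factors, summed over `m < N`, is at most `N ^ (-2)`. -/
lemma coeff313_succ_le (n N : ℕ) :
    coeff313 (n + 1) N ≤ ((N : ℝ) ^ 2)⁻¹ * ∑ l ∈ Finset.range N, coeff313 n l := by
  rcases N with _ | N
  · simp [coeff313_zero_right]
  rw [coeff313_succ]
  have hb : ∀ m ∈ Finset.range (N + 1), (m : ℝ)⁻¹ * ∑ l ∈ Finset.range m, coeff313 n l
      ≤ ∑ l ∈ Finset.range (N + 1), coeff313 n l := fun m hm => by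
    have h1 : (m : ℝ)⁻¹ ≤ 1 := Nat.cast_inv_le_one m
    have h2 : ∑ l ∈ Finset.range m, coeff313 n l ≤ ∑ l ∈ Finset.range (N + 1), coeff313 n l :=
      Finset.sum_le_sum_of_subset_of_nonneg
        (Finset.range_subset_range.mpr (Finset.mem_range.mp hm).le)
        fun l _ _ => coeff313_nonneg n l
    have h3 : 0 ≤ ∑ l ∈ Finset.range m, coeff313 n l :=
      Finset.sum_nonneg fun l _ => coeff313_nonneg n l
    exact (mul_le_of_le_one_left h3 h1).trans h2
  have h := Finset.sum_le_card_nsmul _ _ _ hb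
  rw [Finset.card_range, nsmul_eq_mul] at h
  have hN : ((N + 1 : ℕ) : ℝ) ≠ 0 := by positivity
  calc _ ≤ (((N + 1 : ℕ) : ℝ) ^ 3)⁻¹ * (((N + 1 : ℕ) : ℝ) *
        ∑ l ∈ Finset.range (N + 1), coeff313 n l) := by gcongr
    _ = _ := by field_simp

/-- The left-hand side, a truncated generating function of the `ζ(3, {1, 3}^n)`, grows at most by
the factor `1 + t / N²` from `N` to `N + 1`, because each pair of indices with exponents `3, 1`
contributes at most `N ^ (-2)`. -/
lemma sum_coeff313_le {t : ℝ} (ht : 0 ≤ t) (K N : ℕ) :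
    1 + ∑ n ∈ Finset.range K, t ^ (n + 1) * ∑ l ∈ Finset.range N, coeff313 n l
      ≤ Real.exp (∑ m ∈ Finset.range N, t * ((m : ℝ) ^ 2)⁻¹) := by
  induction N with
  | zero => simp
  | succ N ih =>
    set Q := 1 + ∑ n ∈ Finset.range K, t ^ (n + 1) * ∑ l ∈ Finset.range N, coeff313 n l with hQ
    have hstep : ∑ n ∈ Finset.range K, t ^ (n + 1) * coeff313 n N ≤ t * ((N : ℝ) ^ 2)⁻¹ * Q := by
      rcases K with _ | K
      · simp only [Finset.range_zero, Finset.sum_empty, add_zero] at hQ ⊢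
        rw [hQ]; positivity
      have hnn : 0 ≤ t ^ (K + 1) * ∑ l ∈ Finset.range N, coeff313 K l :=
        mul_nonneg (by positivity) (Finset.sum_nonneg fun l _ => coeff313_nonneg K l)
      rw [Finset.sum_range_succ] at hQ
      rw [Finset.sum_range_succ']
      calc _ ≤ ∑ n ∈ Finset.range K, t ^ (n + 1 + 1) *
              (((N : ℝ) ^ 2)⁻¹ * ∑ l ∈ Finset.range N, coeff313 n l)
            + t ^ (0 + 1) * ((N : ℝ) ^ 2)⁻¹ := by
            gcongr with n hn
            · exact coeff313_succ_le n N
            · exact coeff313_zero_le N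
        _ = t * ((N : ℝ) ^ 2)⁻¹ *
            (1 + ∑ n ∈ Finset.range K, t ^ (n + 1) * ∑ l ∈ Finset.range N, coeff313 n l) := by
            rw [mul_add, Finset.mul_sum, add_comm]
            congr 1
            · ring
            · exact Finset.sum_congr rfl fun n _ => by ring
        _ ≤ t * ((N : ℝ) ^ 2)⁻¹ * Q := by
            gcongr
            linarith
    have hQ0 : 0 ≤ Q := add_nonneg zero_le_one (Finset.sum_nonneg fun n _ =>
      mul_nonneg (by positivity) (Finset.sum_nonneg fun l _ => coeff313_nonneg n l))
    calc _ = Q + ∑ n ∈ Finset.range K, t ^ (n + 1) * coeff313 n N := by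
          rw [hQ, add_assoc, ← Finset.sum_add_distrib]
          congr 1
          exact Finset.sum_congr rfl fun n _ => by rw [Finset.sum_range_succ]; ring
      _ ≤ Q * (t * ((N : ℝ) ^ 2)⁻¹ + 1) := by linarith
      _ ≤ Real.exp (∑ m ∈ Finset.range N, t * ((m : ℝ) ^ 2)⁻¹)
            * Real.exp (t * ((N : ℝ) ^ 2)⁻¹) := by
          gcongr
          exact Real.add_one_le_exp _
      _ = _ := by rw [← Real.exp_add, Finset.sum_range_succ]

/-- The generating function of the `ζ(3, {1, 3}^n)` converges everywhere, as a double series. -/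
lemma summable_coeff313 {t : ℝ} (ht : 0 ≤ t) :
    Summable fun p : ℕ × ℕ => t ^ (p.1 + 1) * coeff313 p.1 p.2 := by
  have hs : Summable fun m : ℕ => t * ((m : ℝ) ^ 2)⁻¹ :=
    (Real.summable_nat_pow_inv (p := 2).mpr one_lt_two).mul_left t
  have hnn : ∀ p : ℕ × ℕ, 0 ≤ t ^ (p.1 + 1) * coeff313 p.1 p.2 := fun p =>
    mul_nonneg (by positivity) (coeff313_nonneg _ _)
  refine summable_of_sum_le (c := Real.exp (∑' m : ℕ, t * ((m : ℝ) ^ 2)⁻¹)) hnn fun u => ?_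
  obtain ⟨K, hK⟩ := (u.image Prod.fst).exists_nat_subset_range
  obtain ⟨N, hN⟩ := (u.image Prod.snd).exists_nat_subset_range
  have hu : u ⊆ Finset.range K ×ˢ Finset.range N := fun p hp => Finset.mem_product.mpr
    ⟨hK (Finset.mem_image_of_mem _ hp), hN (Finset.mem_image_of_mem _ hp)⟩
  refine (Finset.sum_le_sum_of_subset_of_nonneg hu fun p _ _ => hnn p).trans ?_
  rw [Finset.sum_product]
  simp only [← Finset.mul_sum]
  have h1 := sum_coeff313_le ht K N
  have h2 : Real.exp (∑ m ∈ Finset.range N, t * ((m : ℝ) ^ 2)⁻¹)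
      ≤ Real.exp (∑' m : ℕ, t * ((m : ℝ) ^ 2)⁻¹) :=
    Real.exp_le_exp.mpr (hs.sum_le_tsum _ fun m _ => by positivity)
  linarith

lemma summable_coeff313_right (n : ℕ) : Summable (coeff313 n) := by
  simpa using (summable_coeff313 zero_le_one).prod_factor n

lemma summable_coeff313_mul_pow {x : ℝ} (hx0 : 0 ≤ x) (hx1 : x ≤ 1) (n : ℕ) :
    Summable fun N => coeff313 n N * x ^ N :=
  (summable_coeff313_right n).of_nonneg_of_le
    (fun N => mul_nonneg (coeff313_nonneg n N) (pow_nonneg hx0 N))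
    fun N => mul_le_of_le_one_right (coeff313_nonneg n N) (pow_le_one₀ hx0 hx1)

lemma summable_zetaTerm_args313 {x : ℝ} (hx0 : 0 ≤ x) (hx1 : x ≤ 1) (n : ℕ) :
    Summable (zetaTerm x (args313 n)) :=
  summable_zetaTerm hx0 (summable_coeff313_mul_pow hx0 hx1 n)

lemma zetaX_args313 {x : ℝ} (hx0 : 0 ≤ x) (hx1 : x ≤ 1) (n : ℕ) :
    zetaX x (args313 n) = ∑' N, coeff313 n N * x ^ N :=
  zetaX_eq_tsum hx0 (summable_coeff313_mul_pow hx0 hx1 n)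

/-! ### The series `S x z` -/

/-- The coefficient of `x ^ N` in the `n`-th term of `S x z`. -/
noncomputable def doubleTerm (z : ℂ) (n N : ℕ) : ℂ :=
  (-1) ^ n * z ^ (4 * n + 2) * 4 ^ n * (coeff313 n N : ℂ)

/-- The coefficient of `x ^ N` in `S x z`. -/
noncomputable def coeffS (z : ℂ) (N : ℕ) : ℂ := ∑' n, doubleTerm z n N

/-- A bound uniform on the disc `‖z‖ ≤ R`. The base `4 * R ^ 4 + 1` is at least `1`, so that the
exponent can be raised to the `n + 1` of `summable_coeff313`. -/
lemma norm_doubleTerm_le {z : ℂ} {R : ℝ} (hz : ‖z‖ ≤ R) (n N : ℕ) :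
    ‖doubleTerm z n N‖ ≤ R ^ 2 * ((4 * R ^ 4 + 1) ^ (n + 1) * coeff313 n N) := by
  have hR : 0 ≤ R := (norm_nonneg z).trans hz
  have hc := coeff313_nonneg n N
  have h1 : ‖doubleTerm z n N‖ = ‖z‖ ^ (4 * n + 2) * 4 ^ n * coeff313 n N := by
    simp [doubleTerm, abs_of_nonneg hc]
  rw [h1]
  calc ‖z‖ ^ (4 * n + 2) * 4 ^ n * coeff313 n N
      ≤ R ^ (4 * n + 2) * 4 ^ n * coeff313 n N := by gcongr
    _ = R ^ 2 * ((4 * R ^ 4) ^ n * coeff313 n N) := by rw [mul_pow, ← pow_mul]; ring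
    _ ≤ R ^ 2 * ((4 * R ^ 4 + 1) ^ n * coeff313 n N) := by gcongr; linarith
    _ ≤ R ^ 2 * ((4 * R ^ 4 + 1) ^ (n + 1) * coeff313 n N) := by
        gcongr
        · linarith [pow_nonneg hR 4]
        · omega

lemma summable_norm_doubleTerm (z : ℂ) :
    Summable fun p : ℕ × ℕ => ‖doubleTerm z p.1 p.2‖ :=
  ((summable_coeff313 (t := 4 * ‖z‖ ^ 4 + 1) (by positivity)).mul_left (‖z‖ ^ 2)).of_nonneg_of_le
    (fun _ => norm_nonneg _) fun p => norm_doubleTerm_le le_rfl p.1 p.2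

lemma hasSum_coeffS (z : ℂ) (N : ℕ) : HasSum (fun n => doubleTerm z n N) (coeffS z N) :=
  ((summable_norm_doubleTerm z).of_norm.prod_symm.prod_factor N).hasSum

lemma summable_norm_coeffS (z : ℂ) : Summable fun N => ‖coeffS z N‖ := by
  have h := (summable_norm_doubleTerm z).prod_symm
  exact h.prod.of_nonneg_of_le (fun _ => norm_nonneg _) fun N =>
    norm_tsum_le_tsum_norm (h.prod_factor N)

lemma STerm_eq_tsum {x : ℝ} (hx0 : 0 ≤ x) (hx1 : x ≤ 1) (z : ℂ) (n : ℕ) :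
    STerm x z n = ∑' N, doubleTerm z n N * (x : ℂ) ^ N := by
  rw [STerm, zetaX_args313 hx0 hx1, Complex.ofReal_tsum, ← tsum_mul_left]
  refine tsum_congr fun N => ?_
  rw [doubleTerm]
  push_cast
  ring

lemma norm_mul_pow_le {x : ℝ} (hx0 : 0 ≤ x) (hx1 : x ≤ 1) (a : ℂ) (N : ℕ) :
    ‖a * (x : ℂ) ^ N‖ ≤ ‖a‖ := by
  rw [norm_mul, norm_pow, Complex.norm_real, Real.norm_of_nonneg hx0]
  exact mul_le_of_le_one_right (norm_nonneg _) (pow_le_one₀ hx0 hx1)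

lemma summable_doubleTerm_mul_pow {x : ℝ} (hx0 : 0 ≤ x) (hx1 : x ≤ 1) (z : ℂ) :
    Summable fun p : ℕ × ℕ => doubleTerm z p.1 p.2 * (x : ℂ) ^ p.2 :=
  Summable.of_norm_bounded (summable_norm_doubleTerm z) fun _ => norm_mul_pow_le hx0 hx1 _ _

lemma summable_STerm {x : ℝ} (hx0 : 0 ≤ x) (hx1 : x ≤ 1) (z : ℂ) : Summable (STerm x z) :=
  (summable_doubleTerm_mul_pow hx0 hx1 z).prod.congr fun n => (STerm_eq_tsum hx0 hx1 z n).symm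

lemma S_eq_ps {x : ℝ} (hx0 : 0 ≤ x) (hx1 : x ≤ 1) (z : ℂ) : S x z = ps (coeffS z) x := by
  rw [S, tsum_congr (STerm_eq_tsum hx0 hx1 z), ps,
    ← Summable.tsum_comm (f := fun n N => doubleTerm z n N * (x : ℂ) ^ N)
      (summable_doubleTerm_mul_pow hx0 hx1 z)]
  refine tsum_congr fun N => ?_
  rw [tsum_mul_right, coeffS]

lemma differentiable_S {x : ℝ} (hx0 : 0 ≤ x) (hx1 : x ≤ 1) : Differentiable ℂ (S x) := by
  intro z
  set R := ‖z‖ + 1 with hR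
  have hs := (summable_coeff313 (t := 4 * R ^ 4 + 1) (by positivity)).mul_left (R ^ 2)
  have h := Complex.differentiableOn_tsum_of_summable_norm (F := fun n w => STerm x w n)
    (U := Metric.ball 0 R) hs.prod (fun n => by unfold STerm; fun_prop) Metric.isOpen_ball
    fun n w hw => ?_
  · exact h.differentiableAt (Metric.isOpen_ball.mem_nhds (by simp [hR]))
  · have hw : ‖w‖ ≤ R := (mem_ball_zero_iff.mp hw).le
    have hsn := hs.prod_factor n
    rw [STerm_eq_tsum hx0 hx1]
    exact tsum_of_norm_bounded hsn.hasSum fun N =>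
      (norm_mul_pow_le hx0 hx1 _ _).trans (norm_doubleTerm_le hw n N)

/-- The coefficients of `D₁ D₀² S`, where `D₀ = x d/dx` and `D₁ = (1 - x) d/dx`; at `m = 0` only
the first summand `z ^ 2`, which comes from `ζ_x(3)`, is nonzero. -/
noncomputable def coeffS₃ (z : ℂ) (m : ℕ) : ℂ :=
  (if m = 0 then z ^ 2 else 0) + (m : ℂ)⁻¹ * ∑ l ∈ Finset.range m, -4 * z ^ 4 * coeffS z l

lemma coeffS_zero (z : ℂ) : coeffS z 0 = 0 := by
  simp [coeffS, doubleTerm, coeff313_zero_right]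

/-- In terms of coefficients, `D₁ (D₀² S)` is the function with coefficients `coeffS₃`. -/
lemma natCast_cube_mul_coeffS (z : ℂ) (N : ℕ) :
    (N : ℂ) ^ 3 * coeffS z N = ∑ m ∈ Finset.range N, coeffS₃ z m := by
  rcases N with _ | N
  · simp
  have hN : ((N + 1 : ℕ) : ℂ) ≠ 0 := by exact_mod_cast N.succ_ne_zero
  have hsucc : ∀ n, doubleTerm z (n + 1) (N + 1) = (((N + 1 : ℕ) : ℂ) ^ 3)⁻¹ *
      ∑ m ∈ Finset.range (N + 1), (m : ℂ)⁻¹ *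
        ∑ l ∈ Finset.range m, -4 * z ^ 4 * doubleTerm z n l := fun n => by
    simp only [doubleTerm, coeff313_succ, Finset.mul_sum, Complex.ofReal_mul, Complex.ofReal_sum,
      Complex.ofReal_inv, Complex.ofReal_pow, Complex.ofReal_natCast]
    refine Finset.sum_congr rfl fun m _ => Finset.sum_congr rfl fun l _ => ?_
    ring
  have h1 : HasSum (fun n => doubleTerm z (n + 1) (N + 1)) ((((N + 1 : ℕ) : ℂ) ^ 3)⁻¹ *
      ∑ m ∈ Finset.range (N + 1), (m : ℂ)⁻¹ *
        ∑ l ∈ Finset.range m, -4 * z ^ 4 * coeffS z l) := by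
    simp only [hsucc]
    exact (hasSum_sum fun m _ => (hasSum_sum fun l _ =>
      (hasSum_coeffS z l).mul_left _).mul_left _).mul_left _
  rw [coeffS, (hasSum_coeffS z (N + 1)).summable.tsum_eq_zero_add, h1.tsum_eq]
  simp only [coeffS₃, Finset.sum_add_distrib, Finset.sum_ite_eq', Finset.mem_range, N.succ_pos,
    if_true, doubleTerm, coeff313_zero]
  push_cast at hN ⊢
  field_simp

lemma polyBdd_coeffS (z : ℂ) : PolyBdd (coeffS z) :=
  .of_bounded _ fun n => (summable_norm_coeffS z).le_tsum n fun _ _ => norm_nonneg _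

lemma polyBdd_coeffS₃ (z : ℂ) : PolyBdd (coeffS₃ z) := by
  have hs := (summable_norm_coeffS z).mul_left (‖-4 * z ^ 4‖)
  refine .of_bounded (‖z ^ 2‖ + ∑' l, ‖-4 * z ^ 4‖ * ‖coeffS z l‖) fun m => ?_
  refine (norm_add_le _ _).trans (add_le_add ?_ ?_)
  · split_ifs <;> simp
  · rw [norm_mul, norm_inv, Complex.norm_natCast]
    refine (mul_le_of_le_one_left (norm_nonneg _) (Nat.cast_inv_le_one m)).trans ?_
    refine (norm_sum_le _ _).trans ?_
    simp only [norm_mul _ (coeffS z _)]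
    exact hs.sum_le_tsum _ fun _ _ => by positivity

lemma natCast_mul_coeffS₃ (z : ℂ) (m : ℕ) :
    m * coeffS₃ z m = ∑ l ∈ Finset.range m, -4 * z ^ 4 * coeffS z l := by
  rcases m with _ | m
  · simp
  have hm : ((m + 1 : ℕ) : ℂ) ≠ 0 := by exact_mod_cast m.succ_ne_zero
  rw [coeffS₃, if_neg m.succ_ne_zero, zero_add, mul_inv_cancel_left₀ hm]

lemma quarticSystem_S (z : ℂ) : QuarticSystem (z ^ 4) (fun x => ps (coeffS z) x)
    (fun x => ps (fun n => n * coeffS z n) x) (fun x => ps (fun n => n * (n * coeffS z n)) x)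
    (fun x => ps (coeffS₃ z) x) where
  deriv₀ x h0 h1 := (polyBdd_coeffS z).hasDerivAt_div h0 h1
  deriv₁ x h0 h1 := (polyBdd_coeffS z).natCast_mul.hasDerivAt_div h0 h1
  deriv₂ x h0 h1 := (polyBdd_coeffS z).natCast_mul.natCast_mul.hasDerivAt_div_one_sub
    (fun n => by rw [← natCast_cube_mul_coeffS]; ring) h0 h1
  deriv₃ x h0 h1 := ((polyBdd_coeffS₃ z).hasDerivAt_div_one_sub
    (natCast_mul_coeffS₃ z) h0 h1).congr_deriv (by rw [ps_const_mul])

/-! ### The hypergeometric solutions near `0` -/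

lemma PolyBdd.tendsto_ps_zero {c : ℕ → ℂ} (h : PolyBdd c) :
    Tendsto (fun x : ℝ => ps c x) (𝓝[>] 0) (𝓝 (c 0)) := by
  have h1 : ContinuousAt (fun x : ℝ => ps c x) 0 :=
    ContinuousAt.comp (g := ps c) (h.continuousAt_ps (by simp)) (by fun_prop)
  have h2 := h1.tendsto.mono_left (nhdsWithin_le_nhds (s := Set.Ioi 0))
  rwa [Complex.ofReal_zero, ps_zero] at h2

lemma tendsto_ps_one_sub {c : ℕ → ℂ} (h : Summable fun n => ‖c n‖) :
    Tendsto (fun x : ℝ => ps c (1 - x : ℝ)) (𝓝[>] 0) (𝓝 (∑' n, c n)) := by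
  have h1 := (continuousOn_ps h 1 (by simp)).tendsto
  have h2 : Tendsto (fun x : ℝ => 1 - x) (𝓝[>] 0) (𝓝[Set.Icc 0 1] 1) := by
    refine tendsto_nhdsWithin_iff.mpr ⟨?_, ?_⟩
    · have h : Continuous fun x : ℝ => 1 - x := by fun_prop
      simpa only [sub_zero] using (h.tendsto 0).mono_left (nhdsWithin_le_nhds (s := Set.Ioi 0))
    · filter_upwards [Ioo_mem_nhdsGT (zero_lt_one (α := ℝ))] with x hx
      exact ⟨by linarith [hx.2], by linarith [hx.1]⟩
  have h3 : ps c (1 : ℝ) = ∑' n, c n := by simp [ps]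
  exact h3 ▸ h1.comp h2

lemma hypSystem_Y₁ {w z : ℂ} (hw : z ^ 2 = w) : HypSystem w (fun x => ps (coeffY₁ z) x)
    (fun x => -w * ps (coeffY₂ z) x) where
  deriv_a x h0 h1 := ((polyBdd_coeffY₁ z).hasDerivAt_div h0 h1).congr_deriv (by
    simp only [natCast_mul_coeffY₁, ps_const_mul, hw])
  deriv_b x h0 h1 := (((polyBdd_coeffY₂ z).hasDerivAt_div_one_sub (natCast_mul_coeffY₂ z)
    h0 h1).const_mul (-w)).congr_deriv (by ring)

lemma hypSystem_Y₂ {w z : ℂ} (hw : z ^ 2 = w) :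
    HypSystem w (fun x => ps (coeffY₂ z) (1 - x : ℝ)) (fun x => -ps (coeffY₁ z) (1 - x : ℝ)) where
  deriv_a x h0 h1 := (((polyBdd_coeffY₂ z).hasDerivAt_div_one_sub (natCast_mul_coeffY₂ z)
    (x := 1 - x) (by linarith) (by linarith)).comp_const_sub 1 x).congr_deriv (by
      push_cast; rw [sub_sub_cancel, neg_div])
  deriv_b x h0 h1 := (((polyBdd_coeffY₁ z).hasDerivAt_div
    (x := 1 - x) (by linarith) (by linarith)).comp_const_sub 1 x).neg.congr_deriv (by
      simp only [natCast_mul_coeffY₁, ps_const_mul, hw]; push_cast; ring)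

/-- The logarithmic singularity of `Y₂ x z` at `x = 0`. -/
lemma tendsto_Y₂_add_log (z : ℂ) :
    Tendsto (fun x : ℝ => ps (coeffY₂ z) (1 - x : ℝ) + Y₁ 1 z * Real.log x) (𝓝[>] 0)
      (𝓝 (∑' n : ℕ, (eulerProd z n - Y₁ 1 z) / ((n : ℂ) + 1))) := by
  -- `-log x = ∑ (1 - x) ^ n / n`, so the left-hand side is the power series in `1 - x` with the
  -- coefficients `d n`, which is absolutely convergent at `1`
  set d : ℕ → ℂ := fun n => coeffY₂ z n - Y₁ 1 z / n with hd
  have hd_succ : ∀ n : ℕ, d (n + 1) = (eulerProd z n - Y₁ 1 z) / ((n : ℂ) + 1) := fun n => by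
    simp only [hd, coeffY₂]
    push_cast
    ring
  have hs : Summable fun n => ‖d n‖ := by
    obtain ⟨K, -, hK⟩ := exists_eulerProd_sub_bound z
    refine (summable_nat_add_iff 1).mp ((summable_inv_succ_sq.mul_left K).of_nonneg_of_le
      (fun _ => norm_nonneg _) fun n => ?_)
    have : ‖(n : ℂ) + 1‖ = (n : ℝ) + 1 := by exact_mod_cast Complex.norm_natCast (n + 1)
    rw [hd_succ, norm_div, this]
    calc ‖eulerProd z n - Y₁ 1 z‖ / ((n : ℝ) + 1) ≤ K / ((n : ℝ) + 1) / ((n : ℝ) + 1) := by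
          gcongr; exact hK n
      _ = _ := by push_cast; field_simp
  have h := tendsto_ps_one_sub hs
  rw [hs.of_norm.tsum_eq_zero_add, tsum_congr hd_succ, show d 0 = 0 by simp [hd, coeffY₂],
    zero_add] at h
  refine h.congr' ?_
  filter_upwards [Ioo_mem_nhdsGT (zero_lt_one (α := ℝ))] with x hx
  have hx' : ‖((1 - x : ℝ) : ℂ)‖ < 1 := by
    rw [Complex.norm_real, Real.norm_of_nonneg (by linarith [hx.2])]
    linarith [hx.1]
  have h1 := ((polyBdd_coeffY₂ z).summable hx').hasSum.sub
    ((Complex.hasSum_taylorSeries_neg_log hx').mul_left (Y₁ 1 z))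
  have h2 : (1 : ℂ) - (1 - x : ℝ) = x := by push_cast; ring
  rw [h2, ← Complex.ofReal_log hx.1.le] at h1
  rw [ps, tsum_congr (g := fun n => coeffY₂ z n * ((1 - x : ℝ) : ℂ) ^ n
    - Y₁ 1 z * (((1 - x : ℝ) : ℂ) ^ n / n)) fun n => by simp only [hd]; ring, h1.tsum_eq, ps]
  ring

/-- A zero at `0` outweighs the logarithmic singularity of `Y₂`. -/
lemma tendsto_mul_Y₂ (z : ℂ) {f : ℝ → ℂ} {f' : ℂ} (hf : HasDerivAt f f' 0) (hf0 : f 0 = 0) :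
    Tendsto (fun x : ℝ => f x * ps (coeffY₂ z) (1 - x : ℝ)) (𝓝[>] 0) (𝓝 0) := by
  have hid : Tendsto (fun x : ℝ => (x : ℂ)) (𝓝[>] 0) (𝓝 0) := by
    simpa using (Complex.continuous_ofReal.tendsto 0).mono_left (nhdsWithin_le_nhds (s := Set.Ioi 0))
  have hlog : Tendsto (fun x : ℝ => ((x * Real.log x : ℝ) : ℂ)) (𝓝[>] 0) (𝓝 0) := by
    have := ((Complex.continuous_ofReal.comp Real.continuous_mul_log).tendsto 0).mono_left
      (nhdsWithin_le_nhds (s := Set.Ioi 0))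
    simpa only [Function.comp_def, zero_mul, Complex.ofReal_zero] using this
  have h := hf.tendsto_slope_zero_right.mul ((hid.mul (tendsto_Y₂_add_log z)).sub
    (hlog.const_mul (Y₁ 1 z)))
  rw [zero_mul, mul_zero, sub_zero, mul_zero] at h
  refine h.congr' ?_
  filter_upwards [self_mem_nhdsWithin] with x (hx : 0 < x)
  have hx' : (x : ℂ) ≠ 0 := by exact_mod_cast hx.ne'
  rw [zero_add, hf0, sub_zero, Complex.real_smul]
  push_cast
  field_simp
  ring

lemma PolyBdd.hasDerivAt_zero {c : ℕ → ℂ} (h : PolyBdd c) :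
    ∃ f', HasDerivAt (fun x : ℝ => ps c x) f' 0 :=
  ⟨_, (h.hasDerivAt (x := ((0 : ℝ) : ℂ)) (by simp)).comp_ofReal⟩

lemma tendsto_Y₁_sub_one_mul_Y₂ (z z' : ℂ) :
    Tendsto (fun x : ℝ => (ps (coeffY₁ z) x - 1) * ps (coeffY₂ z') (1 - x : ℝ)) (𝓝[>] 0) (𝓝 0) := by
  obtain ⟨f', hf⟩ := (polyBdd_coeffY₁ z).hasDerivAt_zero
  exact tendsto_mul_Y₂ z' (hf.sub_const 1) (by simp [ps_zero, coeffY₁])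

lemma tendsto_coeffY₂_mul_Y₂ (z z' : ℂ) :
    Tendsto (fun x : ℝ => ps (coeffY₂ z) x * ps (coeffY₂ z') (1 - x : ℝ)) (𝓝[>] 0) (𝓝 0) := by
  obtain ⟨f', hf⟩ := (polyBdd_coeffY₂ z).hasDerivAt_zero
  exact tendsto_mul_Y₂ z' hf (by simp [ps_zero, coeffY₂])

/-! ### The identity -/

/-- Both sides solve the same fourth-order system, and their difference vanishes at `0` together
with all components of the system. -/
lemma S_identity_of_lt_one {z : ℂ} (h₁ : ∀ m : ℕ, 1 - z ≠ -m) (h₂ : ∀ m : ℕ, 1 + z ≠ -m)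
    (h₃ : ∀ m : ℕ, 1 - Complex.I * z ≠ -m) (h₄ : ∀ m : ℕ, 1 + Complex.I * z ≠ -m)
    {x : ℝ} (hx0 : 0 < x) (hx1 : x < 1) :
    ps (coeffS z) x = G z * (ps (coeffY₁ z) x * ps (coeffY₁ (Complex.I * z)) x)
      - 1 / (4 * Y₁ 1 z) * (ps (coeffY₂ z) (1 - x : ℝ) * ps (coeffY₁ (Complex.I * z)) x)
      - -(1 / (4 * Y₁ 1 (Complex.I * z)))
        * (ps (coeffY₁ z) x * ps (coeffY₂ (Complex.I * z)) (1 - x : ℝ)) := by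
  have hw : (Complex.I * z) ^ 2 = -z ^ 2 := by rw [mul_pow, Complex.I_sq]; ring
  have hC₁ := Y₁_one_ne_zero h₁ h₂
  have hC₂ := Y₁_one_ne_zero h₃ h₄
  have u₁ := (polyBdd_coeffY₁ z).tendsto_ps_zero
  have u₂ := (polyBdd_coeffY₁ (Complex.I * z)).tendsto_ps_zero
  have v₁ := (polyBdd_coeffY₂ z).tendsto_ps_zero
  have v₂ := (polyBdd_coeffY₂ (Complex.I * z)).tendsto_ps_zero
  have U₁ := tendsto_ps_one_sub (summable_norm_coeffY₁ z)
  have U₂ := tendsto_ps_one_sub (summable_norm_coeffY₁ (Complex.I * z))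
  have y₁ := tendsto_Y₂_add_log z
  have y₂ := tendsto_Y₂_add_log (Complex.I * z)
  rw [tsum_eulerProd_sub h₁ h₂] at y₁
  rw [tsum_eulerProd_sub h₃ h₄] at y₂
  rw [← Y₁_one_eq_tsum] at U₁ U₂
  have uy₁ := tendsto_Y₁_sub_one_mul_Y₂ (Complex.I * z) z
  have uy₂ := tendsto_Y₁_sub_one_mul_Y₂ z (Complex.I * z)
  have vy₁ := tendsto_coeffY₂_mul_Y₂ (Complex.I * z) z
  have vy₂ := tendsto_coeffY₂_mul_Y₂ z (Complex.I * z)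
  have s₀ := (polyBdd_coeffS z).tendsto_ps_zero
  have s₁ := (polyBdd_coeffS z).natCast_mul.tendsto_ps_zero
  have s₂ := (polyBdd_coeffS z).natCast_mul.natCast_mul.tendsto_ps_zero
  have s₃ := (polyBdd_coeffS₃ z).tendsto_ps_zero
  have A := (hypSystem_Y₁ (z := z) rfl).mul (hypSystem_Y₁ hw)
  have B := (hypSystem_Y₂ (z := z) rfl).mul (hypSystem_Y₁ hw)
  have D := (hypSystem_Y₁ (z := z) rfl).mul (hypSystem_Y₂ hw)
  have R := ((A.const_mul (G z)).sub (B.const_mul (1 / (4 * Y₁ 1 z)))).sub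
    (D.const_mul (-(1 / (4 * Y₁ 1 (Complex.I * z)))))
  rw [show (z ^ 2) ^ 2 = z ^ 4 by ring] at R
  set C₁ := Y₁ 1 z
  set C₂ := Y₁ 1 (Complex.I * z)
  have hkey := ((quarticSystem_S z).sub R).eq_zero ?_ ?_ ?_ ?_ hx0 hx1
  · exact sub_eq_zero.mp hkey
  -- the logarithms of `Y₂ x z` and `Y₂ x (I * z)` cancel, and the constants are those of `G z`
  · have h := s₀.sub (((((u₁.mul u₂).const_mul (G z)).sub (uy₁.const_mul (1 / (4 * C₁)))).add
      (uy₂.const_mul (1 / (4 * C₂)))).sub ((y₁.const_mul (1 / (4 * C₁))).sub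
      (y₂.const_mul (1 / (4 * C₂)))))
    refine (h.congr fun x => ?_).trans_eq ?_
    · field_simp
      ring
    · congr 1
      simp only [coeffS_zero, coeffY₁, G]
      field_simp
      ring
  · have h := s₁.sub (((((v₁.const_mul (-z ^ 2)).mul u₂).add
      (u₁.mul (v₂.const_mul (-(-z ^ 2))))).const_mul (G z)).sub
      (((U₁.neg.mul u₂).add (vy₁.const_mul (-(-z ^ 2)))).const_mul (1 / (4 * C₁))) |>.sub
      (((vy₂.const_mul (-z ^ 2)).add (u₁.mul U₂.neg)).const_mul (-(1 / (4 * C₂)))))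
    refine (h.congr fun x => ?_).trans_eq ?_
    · ring
    · congr 1
      simp only [coeffS_zero, coeffY₁, coeffY₂]
      field_simp
      ring
  · have h := s₂.sub (((((v₁.const_mul (-z ^ 2)).mul (v₂.const_mul (-(-z ^ 2)))).const_mul
      2).const_mul (G z)).sub
      (((U₁.neg.mul (v₂.const_mul (-(-z ^ 2)))).const_mul 2).const_mul (1 / (4 * C₁))) |>.sub
      ((((v₁.const_mul (-z ^ 2)).mul U₂.neg).const_mul 2).const_mul (-(1 / (4 * C₂)))))
    refine (h.congr fun x => ?_).trans_eq ?_
    · ring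
    · congr 1
      simp only [coeffS_zero, coeffY₂]
      simp
  · have h := s₃.sub (((((u₂.mul (v₁.const_mul (-z ^ 2))).sub
      (u₁.mul (v₂.const_mul (-(-z ^ 2))))).const_mul (2 * z ^ 2)).const_mul (G z)).sub
      (((u₂.mul U₁.neg).sub (vy₁.const_mul (-(-z ^ 2)))).const_mul (2 * z ^ 2) |>.const_mul
        (1 / (4 * C₁))) |>.sub
      (((vy₂.const_mul (-z ^ 2)).sub (u₁.mul U₂.neg)).const_mul (2 * z ^ 2) |>.const_mul
        (-(1 / (4 * C₂)))))
    refine (h.congr fun x => ?_).trans_eq ?_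
    · ring
    · congr 1
      simp only [coeffS₃, coeffY₁, coeffY₂]
      field_simp
      simp
      ring

/-- The case `x = 1` follows from the case `x < 1` by continuity from the left. -/
lemma S_identity {z : ℂ} (h₁ : ∀ m : ℕ, 1 - z ≠ -m) (h₂ : ∀ m : ℕ, 1 + z ≠ -m)
    (h₃ : ∀ m : ℕ, 1 - Complex.I * z ≠ -m) (h₄ : ∀ m : ℕ, 1 + Complex.I * z ≠ -m)
    {x : ℝ} (hx0 : 0 < x) (hx1 : x ≤ 1) :
    ps (coeffS z) x = G z * (ps (coeffY₁ z) x * ps (coeffY₁ (Complex.I * z)) x)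
      - 1 / (4 * Y₁ 1 z) * (ps (coeffY₂ z) (1 - x : ℝ) * ps (coeffY₁ (Complex.I * z)) x)
      - -(1 / (4 * Y₁ 1 (Complex.I * z)))
        * (ps (coeffY₁ z) x * ps (coeffY₂ (Complex.I * z)) (1 - x : ℝ)) := by
  rcases hx1.lt_or_eq with hx1 | rfl
  · exact S_identity_of_lt_one h₁ h₂ h₃ h₄ hx0 hx1
  have hle : 𝓝[<] (1 : ℝ) ≤ 𝓝[Set.Icc 0 1] 1 := by
    rw [← nhdsWithin_Ioo_eq_nhdsLT zero_lt_one]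
    exact nhdsWithin_mono _ Set.Ioo_subset_Icc_self
  have hc : ∀ {c : ℕ → ℂ}, (Summable fun n => ‖c n‖) →
      Tendsto (fun x : ℝ => ps c x) (𝓝[<] 1) (𝓝 (ps c (1 : ℝ))) := fun h =>
    (continuousOn_ps h 1 (by simp)).tendsto.mono_left hle
  have hy : ∀ {c : ℕ → ℂ}, PolyBdd c →
      Tendsto (fun x : ℝ => ps c (1 - x : ℝ)) (𝓝[<] 1) (𝓝 (ps c (1 - 1 : ℝ))) := fun h => by
    refine ContinuousAt.tendsto (f := fun x : ℝ => ps _ (1 - x : ℝ)) ?_ |>.mono_left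
      nhdsWithin_le_nhds
    exact ContinuousAt.comp (g := ps _) (h.continuousAt_ps (by simp)) (by fun_prop)
  have u₁ := hc (summable_norm_coeffY₁ z)
  have u₂ := hc (summable_norm_coeffY₁ (Complex.I * z))
  have hR := (((u₁.mul u₂).const_mul (G z)).sub
    (((hy (polyBdd_coeffY₂ z)).mul u₂).const_mul (1 / (4 * Y₁ 1 z)))).sub
    ((u₁.mul (hy (polyBdd_coeffY₂ (Complex.I * z)))).const_mul
      (-(1 / (4 * Y₁ 1 (Complex.I * z)))))
  refine tendsto_nhds_unique (hc (summable_norm_coeffS z)) (hR.congr' ?_)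
  filter_upwards [Ioo_mem_nhdsLT (zero_lt_one (α := ℝ))] with x hx
  exact (S_identity_of_lt_one h₁ h₂ h₃ h₄ hx.1 hx.2).symm

end PeriodTwo

theorem proposition1 (x : ℝ) (hx₀ : 0 ≤ x) (hx₁ : x ≤ 1) :
    -- the coefficients of the power series are given by convergent sums
    (∀ n : ℕ, Summable (PeriodTwo.zetaTerm x (PeriodTwo.args313 n))) ∧
    -- the power series converges for every `z` and its sum is entire
    (∀ z : ℂ, Summable (PeriodTwo.STerm x z)) ∧
    Differentiable ℂ (PeriodTwo.S x) ∧
    -- the identity, wherever the functions on its right-hand side are defined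
    (∀ z : ℂ, 0 < x →
      (∀ m : ℕ, 1 ≤ m → z ≠ m ∧ z ≠ -m ∧ z ≠ m * Complex.I ∧ z ≠ -(m * Complex.I)) →
      PeriodTwo.S x z =
        PeriodTwo.G z * PeriodTwo.Y₁ x z * PeriodTwo.Y₁ x (Complex.I * z)
        - PeriodTwo.Y₁ x (Complex.I * z) * PeriodTwo.Y₂ x z / (4 * PeriodTwo.Y₁ 1 z)
        + PeriodTwo.Y₁ x z * PeriodTwo.Y₂ x (Complex.I * z)
            / (4 * PeriodTwo.Y₁ 1 (Complex.I * z))) := by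
  refine ⟨PeriodTwo.summable_zetaTerm_args313 hx₀ hx₁, PeriodTwo.summable_STerm hx₀ hx₁,
    PeriodTwo.differentiable_S hx₀ hx₁, fun z hx hz => ?_⟩
  have hI := Complex.I_mul_I
  have h₁ : ∀ m : ℕ, 1 - z ≠ -m := fun m h => (hz (m + 1) (by omega)).1 (by
    push_cast; linear_combination -h)
  have h₂ : ∀ m : ℕ, 1 + z ≠ -m := fun m h => (hz (m + 1) (by omega)).2.1 (by
    push_cast; linear_combination h)
  have h₃ : ∀ m : ℕ, 1 - Complex.I * z ≠ -m := fun m h => (hz (m + 1) (by omega)).2.2.2 (by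
    push_cast; linear_combination Complex.I * h + z * hI)
  have h₄ : ∀ m : ℕ, 1 + Complex.I * z ≠ -m := fun m h => (hz (m + 1) (by omega)).2.2.1 (by
    push_cast; linear_combination -Complex.I * h + z * hI)
  have hx' : ‖(1 - x : ℂ)‖ < 1 := by
    rw [← Complex.ofReal_one, ← Complex.ofReal_sub, Complex.norm_real,
      Real.norm_of_nonneg (by linarith)]
    linarith
  rw [PeriodTwo.S_eq_ps hx₀ hx₁, PeriodTwo.S_identity h₁ h₂ h₃ h₄ hx hx₁,
    PeriodTwo.Y₁_eq_ps x z, PeriodTwo.Y₁_eq_ps x (Complex.I * z),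
    PeriodTwo.Y₂_eq_ps x z ((PeriodTwo.polyBdd_coeffY₂ z).summable hx'),
    PeriodTwo.Y₂_eq_ps x _ ((PeriodTwo.polyBdd_coeffY₂ (Complex.I * z)).summable hx')]
  push_cast
  ring
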